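/- An $n$-chord diagram is an oriented circle with $2n$ distinct points paired into $n$ disjoint pairs (chords), up to orientation-preserving diffeomorphisms of the circle; with the points labelled $1,2,\dots,2n$ counterclockwise it is written as the list of its chords $(p_i,p_i^*)$, $1\le i\le n$. The universal $\mathrm{sl}_2$ weight $\varphi=\varphi_{\mathrm{sl}_2,2}$ is the unique function from chord diagrams to $\mathbb{Z}[x]$ such that $\varphi=x$ on the $1$-chord diagram and, for every $n$-chord diagram $\mathcal{D}$ with $n\ge 2$ and every chord $a$ of $\mathcal{D}$, $$\varphi(\mathcal{D})=(x-k)\,\varphi(\mathcal{D}_a)+\sum_{\{i,j\}\subset I_a}\bigl(\varphi(\mathcal{D}^1_{i,j})-\varphi(\mathcal{D}^2_{i,j})\bigr).$$ Here $\mathcal{D}_a$ is $\mathcal{D}$ with the chord $a$ deleted, $I_a$ indexes the chords of $\mathcal{D}$ that intersect $a$, $k=\#I_a$, the sum is over unordered pairs of distinct indices, and, writing each chord of $I_a$ as $(p_i,p_i^*)$ with $p_i$ on one fixed side of $a$ and $p_i^*$ on the other, $\mathcal{D}^1_{i,j}$ (resp. $\mathcal{D}^2_{i,j}$) is obtained from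 $\mathcal{D}_a$ by replacing the chords $(p_i,p_i^*)$ and $(p_j,p_j^*)$ by $(p_i,p_j)$ and $(p_i^*,p_j^*)$ (resp. by $(p_i,p_j^*)$ and $(p_j,p_i^*)$). Let $\mathcal{D}_n=((i,n+i):1\le i\le n)$ be the diagram in which every chord meets every other chord. For $n\ge1$ and $0\le k\le n-1$ let $\mathcal{A}_{n,k}$ be the $n$-chord diagram with chords $(p_i,p_i^*)$, $1\le i\le n$, whose endpoints are, counterclockwise, $$p_1,p_2,\dots,p_{k+1},\;p_1^*,\;p_{k+2},\dots,p_n,\;p_2^*,p_3^*,\dots,p_n^*.$$ For $0\le k\le n-2$ let $\mathcal{B}_{n,k}$ be the $n$-chord diagram whose endpoints are, counterclockwise, $$p_1,p_2,\dots,p_{k+1},\;p_1^*,\;p_{k+2},\dots,p_n,\;p_2^*,\dots,p_{k+1}^*,\;p_n^*,\;p_{k+2}^*,\dots,p_{n-1}^*,$$ and let $\mathcal{B}_{n,n-1}=\mathcal{D}_n$. Put $A_{n,k}=\varphi(\mathcal{A}_{n,k})$ and $B_{n,k}=\varphi(\mathcal{B}_{n,k})$ for $0\le k\le n-1$, and $A_{n,-1}=0$,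 $B_{n,-1}=-x\,\varphi(\mathcal{D}_n)$. Let $(K_{n,k})_{1\le k\le n}$ be the polynomials defined by $K_{1,1}=x$ and, for $n\ge 2$ and $3\le k\le n$, $$K_{n,1}=(x-1)K_{n-1,1}-K_{n-1,2}-\dots-K_{n-1,n-1},$$ $$K_{n,2}=2K_{n,1}+K_{n-1,1}-x^2K_{n-2,1},$$ $$K_{n,k}=2K_{n,k-1}-K_{n,k-2}+K_{n-1,k-1}+K_{n-1,k-2}+2xK_{n-2,k-2},$$ with $K_{0,1}=1$, and put $K_{n,0}=-xK_{n,1}$ for all $n\ge 0$. Theorem. The function $\varphi$ is well defined, and for all $n\ge1$ and $0\le k\le n-1$, $$A_{n,k-1}-A_{n,k}=K_{n-1,k},\qquad B_{n,k-1}-B_{n,n-k-1}=K_{n,k}-K_{n,k+1}.$$ In particular $\varphi(\mathcal{D}_n)=K_{n,1}$ for all $n\ge1$. -/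

import Mathlib

open Polynomial

namespace ChordWeight

/-! ### Chord diagrams

The marked points of the oriented circle are represented by natural numbers, met in increasing
order when one goes around the circle counterclockwise from a base point. The labels need not be
consecutive: only the cyclic order of the points matters. A chord is an unordered pair of points,
and a diagram is the finite set of its chords; its order is the number of its chords. -/

/-- The marked points of a set of chords. -/
def points (D : Finset (Sym2 ℕ)) : Finset ℕ := D.biUnion fun c => c.toFinset

/-- `D` is a chord diagram: every chord has two distinct endpoints, and distinct chords have no
common endpoint. -/
def IsChordDiagram (D : Finset (Sym2 ℕ)) : Prop :=
  (∀ c ∈ D, ¬ c.IsDiag) ∧ ∀ c ∈ D, ∀ d ∈ D, c ≠ d → ∀ p : ℕ, p ∈ c → p ∉ d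

/-- `p`, `q`, `r` are distinct and met in this cyclic order counterclockwise. -/
def CyclicallyOrdered (p q r : ℕ) : Prop :=
  (p < q ∧ q < r) ∨ (q < r ∧ r < p) ∨ (r < p ∧ p < q)

/-- `D` and `D'` represent the same chord diagram up to orientation-preserving diffeomorphism of
the circle: some cyclic-order-preserving relabelling of the points carries `D` to `D'`. -/
def SameDiagram (D D' : Finset (Sym2 ℕ)) : Prop :=
  ∃ f : ℕ → ℕ, Set.InjOn f (points D) ∧ D' = D.image (Sym2.map f) ∧
    ∀ p ∈ points D, ∀ q ∈ points D, ∀ r ∈ points D,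
      CyclicallyOrdered p q r → CyclicallyOrdered (f p) (f q) (f r)

/-! ### The universal sl₂ weight -/

/-- The chords of `D` that intersect the chord `a`, each written as a pair `(p, p*)` whose first
entry `p` is the endpoint that lies on one fixed side of `a` (strictly between the two labels
of `a`) and whose second entry `p*` is the endpoint on the other side. -/
def crossing (D : Finset (Sym2 ℕ)) (a : Sym2 ℕ) : Finset (ℕ × ℕ) :=
  (points D ×ˢ points D).filter fun c =>
    s(c.1, c.2) ∈ D ∧ (a.inf < c.1 ∧ c.1 < a.sup) ∧ (c.2 < a.inf ∨ a.sup < c.2)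

/-- Delete `a` from `D` and replace the chords `c = (p, p*)` and `d = (q, q*)` by `(p, q)` and
`(p*, q*)`. -/
def reconnectSame (D : Finset (Sym2 ℕ)) (a : Sym2 ℕ) (c d : ℕ × ℕ) : Finset (Sym2 ℕ) :=
  insert s(c.1, d.1) (insert s(c.2, d.2) (((D.erase a).erase s(c.1, c.2)).erase s(d.1, d.2)))

/-- Delete `a` from `D` and replace the chords `c = (p, p*)` and `d = (q, q*)` by `(p, q*)` and
`(q, p*)`. -/
def reconnectCross (D : Finset (Sym2 ℕ)) (a : Sym2 ℕ) (c d : ℕ × ℕ) : Finset (Sym2 ℕ) :=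
  insert s(c.1, d.2) (insert s(d.1, c.2) (((D.erase a).erase s(c.1, c.2)).erase s(d.1, d.2)))

/-- The right-hand side of the Chmutov–Varchenko recursion for `D` along its chord `a`:
`(x - k) φ(D_a) + ∑_{i,j} (φ(D¹_{i,j}) - φ(D²_{i,j}))`, where `k` is the number of chords that
intersect `a` and the sum is over the unordered pairs of such chords (each pair is listed once, by
requiring `p < q`). -/
noncomputable def recursionRHS (φ : Finset (Sym2 ℕ) → ℤ[X]) (D : Finset (Sym2 ℕ)) (a : Sym2 ℕ) :
    ℤ[X] :=
  (X - ((crossing D a).card : ℤ[X])) * φ (D.erase a) +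
    ∑ cd ∈ (crossing D a ×ˢ crossing D a).filter (fun cd => cd.1.1 < cd.2.1),
      (φ (reconnectSame D a cd.1 cd.2) - φ (reconnectCross D a cd.1 cd.2))

/-- The weight computed in `n` steps of the recursion, each along an arbitrarily chosen chord. -/
noncomputable def weightAux : ℕ → Finset (Sym2 ℕ) → ℤ[X]
  | 0, _ => 1
  | n + 1, D =>
    open Classical in
    if h : D.Nonempty then recursionRHS (weightAux n) D h.choose else 0

/-- The universal sl₂ weight `φ = φ_{sl₂,2}`. The empty diagram has weight `1`, so that the
diagram with one chord has weight `x`. -/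
noncomputable def weight (D : Finset (Sym2 ℕ)) : ℤ[X] := weightAux D.card D

/-- The properties that make `φ` the universal sl₂ weight on chord diagrams: the one-chord diagram
has weight `x`, the recursion holds for *every* chord of every diagram of order at least `2`,
and equal diagrams have equal weights. -/
structure IsUniversalSl2Weight (φ : Finset (Sym2 ℕ) → ℤ[X]) : Prop where
  one_chord : ∀ D, IsChordDiagram D → D.card = 1 → φ D = X
  recursion : ∀ D, IsChordDiagram D → 2 ≤ D.card → ∀ a ∈ D, φ D = recursionRHS φ D a
  invariant : ∀ D D', IsChordDiagram D → IsChordDiagram D' → SameDiagram D D' → φ D = φ D'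

/-! ### The families of diagrams -/

/-- `𝒟_n`, with chords `(i, n + i)`, `1 ≤ i ≤ n`: all chords intersect each other. -/
def diagramD (n : ℕ) : Finset (Sym2 ℕ) :=
  (Finset.Icc 1 n).image fun i => s(i, n + i)

/-- `𝒜_{n,k}`, `0 ≤ k ≤ n - 1`: the points are, counterclockwise,
`p_1, p_2, …, p_{k+1}, p_1*, p_{k+2}, …, p_n, p_2*, …, p_n*`. -/
def diagramA (n k : ℕ) : Finset (Sym2 ℕ) :=
  (Finset.Icc 1 n).image fun i =>
    if i = 1 then s(1, k + 2)
    else if i ≤ k + 1 then s(i, n + i)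
    else s(i + 1, n + i)

/-- `ℬ_{n,k}`: for `0 ≤ k ≤ n - 2` the points are, counterclockwise,
`p_1, p_2, …, p_{k+1}, p_1*, p_{k+2}, …, p_n, p_2*, …, p_{k+1}*, p_n*, p_{k+2}*, …, p_{n-1}*`;
for `k = n - 1` it is `𝒟_n`. -/
def diagramB (n k : ℕ) : Finset (Sym2 ℕ) :=
  (Finset.Icc 1 n).image fun i =>
    if i = 1 then s(1, k + 2)
    else if i ≤ k + 1 then s(i, n + i)
    else if i < n then s(i + 1, n + i + 1)
    else s(n + 1, n + k + 2)

/-- `A_{n,k} = φ(𝒜_{n,k})` for `k ≥ 0`, and `A_{n,-1} = 0`. -/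
noncomputable def polyA (n : ℕ) (k : ℤ) : ℤ[X] :=
  if k < 0 then 0 else weight (diagramA n k.toNat)

/-- `B_{n,k} = φ(ℬ_{n,k})` for `k ≥ 0`, and `B_{n,-1} = -x φ(𝒟_n)`. -/
noncomputable def polyB (n : ℕ) (k : ℤ) : ℤ[X] :=
  if k < 0 then -X * weight (diagramD n) else weight (diagramB n k.toNat)

/-! ### The polynomial Kreweras triangle -/

/-- The triangle `K_{n,k}` for `1 ≤ k ≤ n`, with `K_{0,1} = 1`; the other values are junk. -/
noncomputable def krewerasAux : ℕ → ℕ → ℤ[X]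
  | 0, _ => 1
  | 1, _ => X
  | _ + 2, 0 => 0
  | n + 2, 1 => (X - 1) * krewerasAux (n + 1) 1 - ∑ i ∈ Finset.Icc 2 (n + 1), krewerasAux (n + 1) i
  | n + 2, 2 => 2 * krewerasAux (n + 2) 1 + krewerasAux (n + 1) 1 - X ^ 2 * krewerasAux n 1
  | n + 2, k + 3 =>
    2 * krewerasAux (n + 2) (k + 2) - krewerasAux (n + 2) (k + 1) + krewerasAux (n + 1) (k + 2)
      + krewerasAux (n + 1) (k + 1) + 2 * X * krewerasAux n (k + 1)

/-- The triangle `K_{n,k}` for `0 ≤ k ≤ n`, with `K_{n,0} = -x K_{n,1}` and `K_{0,1} = 1`. -/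
noncomputable def kreweras (n k : ℕ) : ℤ[X] :=
  if k = 0 then -X * krewerasAux n 1 else krewerasAux n k

end ChordWeight

namespace ChordWeight

/-! ### A trace on a representation of `sl₂` -/

/-! The weight is the classical `sl₂` weight system. Take an algebra with elements `J 0, J 1, J 2`
satisfying `[J a, J b] = ∑ i ε_abc J c`, with scalar Casimir element `∑ J a * J a = x` and a
normalized trace. Give each chord a color in `Fin 3`, multiply the corresponding `J`'s around the
circle, take the trace, and sum over all colorings. By cyclicity of the trace this value depends
only on the diagram up to rotation.

The recursion comes from `J P J = (J²P + PJ² - [J,[J,P]]) / 2`, where `P` is the word on one side of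
the chord `a`. After summation the first two terms give `x P`. The double commutator is an action of
`sl₂` on the letters of `P`; moved to the tensor of the chords, it cancels on chords with both ends
in `P`. Only the chords crossing `a` remain. A crossing chord hit twice gives the adjoint Casimir
eigenvalue `2`, hence `-k`; two different ones give, by the contraction of two Levi-Civita symbols,
the difference of the two reconnections (`Sl2Trace.diagramVal_recursion`).

The irreducible representation of dimension `2l+1` realizes `x = l(l+1)`. A polynomial is determined
by these infinitely many values, so every identity between weights may be checked on traces
(`eq_of_forall_aeval_spin`). This gives the three properties of the universal weight.

In `𝒟`, `𝒜`, `ℬ` the mutually crossing chords form blocks that read the same word twice, so their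
values are `D n = ∑ tr(ww)`, `A(a,b) = ∑ tr(s w s z w z)`, `B(a,b) = ∑ tr(u w u z v w v z)`, with
`w`, `z` running over words of lengths `a`, `b`. Commutator identities give the two relations
`A(q,m+2) - 2A(q+1,m+1) + A(q+2,m) = B(q,m) - B(m,q)` (`Sl2Trace.valA_second_difference`) and
`B(q,m+1) - B(q+1,m) + B(m,q+1) - B(m+1,q) = A(q,m+2) - A(q+2,m) + 2x(A(q,m+1) - A(q+1,m))`
(`Sl2Trace.valB_difference`), besides boundary values at `a = 0`, `a = 1` and `b = 0`. For the first
differences `A_{n+1,k} - A_{n+1,k+1}` these are exactly the recursions of `K_{n,k+1}`: telescoping a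
row gives the one for `K_{n,1}`, the first relation at the edge gives `K_{n,2}`, and eliminating `B`
between the two relations gives the rest. The statement on `B` is then the first relation again. -/

/-- The Levi-Civita symbol. -/
def leviCivita (a b c : Fin 3) : ℤ := ((b : ℤ) - a) * ((c : ℤ) - a) * ((c : ℤ) - b) / 2

/-- The structure constants of `sl₂` in an orthonormal basis. -/
noncomputable def structureConst (a b c : Fin 3) : ℂ := Complex.I * leviCivita a b c

theorem structureConst_swap (t a b : Fin 3) : structureConst t a b = -structureConst t b a := by
  have h : leviCivita t a b = -leviCivita t b a := by revert t a b; decide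
  simp [structureConst, h]

theorem structureConst_swap_left (t a b : Fin 3) :
    structureConst t a b = -structureConst a t b := by
  have h : leviCivita t a b = -leviCivita a t b := by revert t a b; decide
  simp [structureConst, h]

/-- The Levi-Civita contraction identity, with the sign reversed by `i² = -1`. Its two products of
deltas are the source of the two reconnections of a pair of chords. -/
theorem sum_structureConst_mul (a b c d : Fin 3) :
    ∑ t, structureConst t a b * structureConst t c d =
      (if a = d then 1 else 0) * (if b = c then 1 else 0) -
        (if a = c then 1 else 0) * (if b = d then 1 else 0) := by
  have h : ∑ t, leviCivita t a b * leviCivita t c d =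
      (if a = c then 1 else 0) * (if b = d then 1 else 0) -
      (if a = d then 1 else 0) * (if b = c then 1 else 0) := by
    revert a b c d; decide
  have h2 := congrArg (Int.cast : ℤ → ℂ) h
  push_cast at h2
  have h3 : ∑ t, structureConst t a b * structureConst t c d =
      -∑ t, (leviCivita t a b : ℂ) * leviCivita t c d := by
    rw [← Finset.sum_neg_distrib]
    refine Finset.sum_congr rfl fun t _ => ?_
    simp only [structureConst]
    linear_combination (leviCivita t a b : ℂ) * leviCivita t c d * Complex.I_mul_I
  rw [h3, h2]; ring

/-- An associative algebra containing three elements that satisfy the commutation relations of an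
orthonormal basis of `sl₂` and whose Casimir element is the scalar `x`, with a normalized trace. -/
structure Sl2Trace (A : Type*) [Ring A] [Algebra ℂ A] where
  J : Fin 3 → A
  x : ℂ
  tr : A →ₗ[ℂ] ℂ
  commutator : ∀ a b, J a * J b - J b * J a = ∑ c, structureConst a b c • J c
  casimir : ∑ a, J a * J a = x • 1
  tr_mul_comm : ∀ a b, tr (a * b) = tr (b * a)
  tr_one : tr 1 = 1

/-! ### Sums over colorings of points -/

/-- Sum over the colors of the point `p`. -/
def colorSum (p : ℕ) (F : (ℕ → Fin 3) → ℂ) (κ : ℕ → Fin 3) : ℂ :=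
  ∑ c, F (Function.update κ p c)

/-- Summations over two points commute, which makes the fold over a list invariant under
permutations. -/
instance : LeftCommutative colorSum where
  left_comm p q F := by
    rcases eq_or_ne p q with rfl | h
    · rfl
    · funext κ
      simp only [colorSum]
      rw [Finset.sum_comm]
      simp_rw [Function.update_comm h]

/-- Sum over the colors of the points of a list. -/
def colorSumList (L : List ℕ) (F : (ℕ → Fin 3) → ℂ) : (ℕ → Fin 3) → ℂ := L.foldr colorSum F

theorem colorSumList_perm {L L' : List ℕ} (h : L.Perm L') (F : (ℕ → Fin 3) → ℂ) :
    colorSumList L F = colorSumList L' F := h.foldr_eq F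

@[simp] theorem colorSumList_nil (F : (ℕ → Fin 3) → ℂ) : colorSumList [] F = F := rfl

theorem colorSumList_cons (p : ℕ) (L : List ℕ) (F : (ℕ → Fin 3) → ℂ) :
    colorSumList (p :: L) F = colorSum p (colorSumList L F) := rfl

theorem colorSumList_append (L L' : List ℕ) (F : (ℕ → Fin 3) → ℂ) :
    colorSumList (L ++ L') F = colorSumList L (colorSumList L' F) := by
  simp [colorSumList]

theorem colorSumList_sum {ι : Type*} (L : List ℕ) (s : Finset ι)
    (F : ι → (ℕ → Fin 3) → ℂ) (κ : ℕ → Fin 3) :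
    colorSumList L (fun κ => ∑ i ∈ s, F i κ) κ = ∑ i ∈ s, colorSumList L (F i) κ := by
  induction L generalizing κ with
  | nil => rfl
  | cons p L ih =>
    simp only [colorSumList_cons, colorSum, ih]
    rw [Finset.sum_comm]

theorem colorSumList_mul_left (L : List ℕ) (r : ℂ) (F : (ℕ → Fin 3) → ℂ) (κ : ℕ → Fin 3) :
    colorSumList L (fun κ => r * F κ) κ = r * colorSumList L F κ := by
  induction L generalizing κ with
  | nil => rfl
  | cons p L ih => simp only [colorSumList_cons, colorSum, ih, Finset.mul_sum]

theorem colorSumList_add (L : List ℕ) (F G : (ℕ → Fin 3) → ℂ) (κ : ℕ → Fin 3) :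
    colorSumList L (fun κ => F κ + G κ) κ = colorSumList L F κ + colorSumList L G κ := by
  induction L generalizing κ with
  | nil => rfl
  | cons p L ih => simp only [colorSumList_cons, colorSum, ih, Finset.sum_add_distrib]

/-- Sums over colorings are compatible with relabelling of the points. -/
theorem colorSumList_map {f : ℕ → ℕ} {F F' : (ℕ → Fin 3) → ℂ} (L S : List ℕ)
    (hf : Set.InjOn f {p | p ∈ S ++ L})
    (hF : ∀ κ κ' : ℕ → Fin 3, (∀ p ∈ S ++ L, κ' (f p) = κ p) → F' κ' = F κ)
    (κ κ' : ℕ → Fin 3) (hκ : ∀ p ∈ S, κ' (f p) = κ p) :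
    colorSumList (L.map f) F' κ' = colorSumList L F κ := by
  -- `S` collects the points whose colors are already fixed; the two colorings have to agree only
  -- there.
  induction L generalizing S κ κ' with
  | nil => exact hF κ κ' (by simpa using hκ)
  | cons p L ih =>
    simp only [List.map_cons, colorSumList_cons, colorSum]
    refine Finset.sum_congr rfl fun c _ => ih (S ++ [p]) (by simpa using hf)
      (by simpa using hF) _ _ ?_
    intro q hq
    rcases eq_or_ne q p with rfl | hqp
    · simp
    · have hqS : q ∈ S := by simpa [hqp] using hq
      have : f q ≠ f p := fun h => hqp (hf (by simp [hqS]) (by simp) h)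
      rw [Function.update_of_ne this, Function.update_of_ne hqp, hκ q hqS]

/-! ### The action of `sl₂` on functions of a coloring -/

/-- The action of the basis element `t` of `sl₂` on the tensor factor of the point `p`. -/
noncomputable def act {M : Type*} [AddCommGroup M] [Module ℂ M] (t : Fin 3) (p : ℕ) :
    ((ℕ → Fin 3) → M) →ₗ[ℂ] ((ℕ → Fin 3) → M) where
  toFun F κ := ∑ l, structureConst t (κ p) l • F (Function.update κ p l)
  map_add' F G := by funext κ; simp [Finset.sum_add_distrib]
  map_smul' r F := by
    funext κ
    simp only [Pi.smul_apply, RingHom.id_apply, Finset.smul_sum]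
    exact Finset.sum_congr rfl fun l _ => smul_comm _ _ _

section
variable {M : Type*} [AddCommGroup M] [Module ℂ M]

theorem act_apply (t : Fin 3) (p : ℕ) (F : (ℕ → Fin 3) → M) (κ : ℕ → Fin 3) :
    act t p F κ = ∑ l, structureConst t (κ p) l • F (Function.update κ p l) := rfl

theorem act_comm {p q : ℕ} (h : p ≠ q) (t s : Fin 3) (F : (ℕ → Fin 3) → M) :
    act t p (act s q F) = act s q (act t p F) := by
  funext κ
  simp only [act_apply, Function.update_of_ne h, Function.update_of_ne h.symm, Finset.smul_sum]
  rw [Finset.sum_comm]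
  refine Finset.sum_congr rfl fun l _ => Finset.sum_congr rfl fun m _ => ?_
  rw [smul_comm, Function.update_comm h]

/-- The Casimir element acts on the adjoint representation by `2`. With the factor `-1/2` of the
double commutator, this is where the `-k` of the recursion comes from. -/
theorem sum_act_act (p : ℕ) (F : (ℕ → Fin 3) → M) :
    ∑ t, act t p (act t p F) = (2 : ℂ) • F := by
  funext κ
  simp only [Finset.sum_apply, act_apply, Function.update_self, Function.update_idem,
    Finset.smul_sum, smul_smul, Pi.smul_apply]
  have h : ∀ m, ∑ t, ∑ l, structureConst t (κ p) l * structureConst t l m =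
      if m = κ p then (2 : ℂ) else 0 := by
    intro m
    rw [Finset.sum_comm]
    simp only [sum_structureConst_mul]
    generalize κ p = a
    fin_cases m <;> fin_cases a <;> norm_num [Fin.sum_univ_three]
  calc ∑ t, ∑ l, ∑ m, (structureConst t (κ p) l * structureConst t l m) • F (Function.update κ p m)
      = ∑ m, (∑ t, ∑ l, structureConst t (κ p) l * structureConst t l m) •
          F (Function.update κ p m) := by
        simp only [Finset.sum_smul]
        symm
        rw [Finset.sum_comm]
        exact Finset.sum_congr rfl fun t _ => Finset.sum_comm
    _ = _ := by simp [h]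

/-- The action on a product of basis elements is the commutator. -/
theorem Sl2Trace.sum_act_prod {A : Type*} [Ring A] [Algebra ℂ A] (R : Sl2Trace A) (t : Fin 3)
    (L : List ℕ) (hL : L.Nodup) :
    ∑ p ∈ L.toFinset, act t p (fun κ => (L.map fun p => R.J (κ p)).prod) =
      fun κ => R.J t * (L.map fun p => R.J (κ p)).prod -
        (L.map fun p => R.J (κ p)).prod * R.J t := by
  induction L with
  | nil => funext κ; simp
  | cons p L ih =>
    obtain ⟨hp, hL⟩ := List.nodup_cons.1 hL
    specialize ih hL
    rw [List.toFinset_cons, Finset.sum_insert (by simpa using hp)]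
    funext κ
    have h1 : ∀ q ∈ L.toFinset,
        act t q (fun κ => ((p :: L).map fun p => R.J (κ p)).prod) κ =
          R.J (κ p) * act t q (fun κ => (L.map fun p => R.J (κ p)).prod) κ := by
      intro q hq
      have hqp : p ≠ q := by rintro rfl; exact hp (by simpa using hq)
      simp only [act_apply, List.map_cons, List.prod_cons, Function.update_of_ne hqp,
        Finset.mul_sum, mul_smul_comm]
    have h2 : ∀ l, (L.map fun q => R.J (Function.update κ p l q)) = L.map fun q => R.J (κ q) := by
      intro l
      refine List.map_congr_left fun q hq => ?_
      rw [Function.update_of_ne (by rintro rfl; exact hp hq)]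
    have h3 := congrFun ih κ
    rw [Finset.sum_apply] at h3
    rw [Pi.add_apply, Finset.sum_apply, Finset.sum_congr rfl h1, ← Finset.mul_sum, h3, act_apply]
    -- Leibniz rule: `[J t, J c * w] = [J t, J c] * w + J c * [J t, w]`.
    simp only [List.map_cons, List.prod_cons, h2, Function.update_self]
    simp only [← smul_mul_assoc, ← Finset.sum_mul, ← R.commutator]
    noncomm_ring

theorem act_comp_linearMap {N : Type*} [AddCommGroup N] [Module ℂ N] (t : Fin 3) (p : ℕ)
    (g : (ℕ → Fin 3) → M →ₗ[ℂ] N) (hg : ∀ κ l, g (Function.update κ p l) = g κ)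
    (F : (ℕ → Fin 3) → M) :
    act t p (fun κ => g κ (F κ)) = fun κ => g κ (act t p F κ) := by
  funext κ
  simp [act_apply, hg]

/-- The action is antisymmetric with respect to the pairing of functions of a coloring. -/
theorem colorSumList_mul_act (t : Fin 3) {p : ℕ} {L : List ℕ} (hp : p ∈ L)
    (F G : (ℕ → Fin 3) → ℂ) (κ : ℕ → Fin 3) :
    colorSumList L (fun κ => F κ * act t p G κ) κ =
      -colorSumList L (fun κ => act t p F κ * G κ) κ := by
  -- With the color of `p` summed innermost, the claim is an exchange of two summation indices and
  -- the antisymmetry of the structure constants.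
  have h := (List.perm_cons_erase hp).trans (List.perm_append_singleton p (L.erase p)).symm
  simp only [colorSumList_perm h]
  rw [colorSumList_append, colorSumList_append, ← neg_one_mul, ← colorSumList_mul_left]
  congr 1
  funext κ
  simp only [colorSumList_cons, colorSumList_nil, colorSum, act_apply, Function.update_self,
    Function.update_idem, smul_eq_mul, Finset.mul_sum, Finset.sum_mul]
  rw [Finset.sum_comm]
  refine Finset.sum_congr rfl fun c _ => Finset.sum_congr rfl fun l _ => ?_
  rw [structureConst_swap]
  ring

/-! ### The invariant tensor of a chord diagram -/

/-- The points of the chord have the same color. -/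
def chordDelta (c : Sym2 ℕ) (κ : ℕ → Fin 3) : ℂ := if (c.map κ).IsDiag then 1 else 0

theorem chordDelta_mk (p q : ℕ) (κ : ℕ → Fin 3) :
    chordDelta s(p, q) κ = if κ p = κ q then 1 else 0 := by
  simp [chordDelta]

theorem chordDelta_update {c : Sym2 ℕ} {p : ℕ} (hp : p ∉ c) (κ : ℕ → Fin 3) (l : Fin 3) :
    chordDelta c (Function.update κ p l) = chordDelta c κ := by
  induction c with
  | h a b =>
    simp only [Sym2.mem_iff, not_or] at hp
    simp [chordDelta_mk, Function.update_of_ne (Ne.symm hp.1), Function.update_of_ne (Ne.symm hp.2)]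

/-- The points of each chord of `D` have the same color. -/
def diagramDelta (D : Finset (Sym2 ℕ)) (κ : ℕ → Fin 3) : ℂ := ∏ c ∈ D, chordDelta c κ

theorem diagramDelta_update {D : Finset (Sym2 ℕ)} {p : ℕ} (hp : ∀ c ∈ D, p ∉ c)
    (κ : ℕ → Fin 3) (l : Fin 3) :
    diagramDelta D (Function.update κ p l) = diagramDelta D κ :=
  Finset.prod_congr rfl fun c hc => chordDelta_update (hp c hc) κ l

theorem diagramDelta_insert {D : Finset (Sym2 ℕ)} {c : Sym2 ℕ} (hc : c ∉ D) (κ : ℕ → Fin 3) :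
    diagramDelta (insert c D) κ = chordDelta c κ * diagramDelta D κ := Finset.prod_insert hc

theorem act_chordDelta {p q : ℕ} (hpq : p ≠ q) (t : Fin 3) (G : (ℕ → Fin 3) → ℂ)
    (hp : ∀ κ l, G (Function.update κ p l) = G κ) (κ : ℕ → Fin 3) :
    act t p (fun κ => chordDelta s(p, q) κ * G κ) κ = structureConst t (κ p) (κ q) * G κ := by
  simp [act_apply, chordDelta_mk, hp, Function.update_of_ne hpq.symm]

/-- The tensor of a chord is invariant. -/
theorem act_add_act_chord {p q : ℕ} (hpq : p ≠ q) (t : Fin 3) (G : (ℕ → Fin 3) → ℂ)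
    (hp : ∀ κ l, G (Function.update κ p l) = G κ) (hq : ∀ κ l, G (Function.update κ q l) = G κ) :
    act t p (fun κ => chordDelta s(p, q) κ * G κ) + act t q (fun κ => chordDelta s(p, q) κ * G κ)
      = 0 := by
  funext κ
  have h := act_chordDelta hpq.symm t G hq κ
  rw [Sym2.eq_swap] at h
  rw [Pi.add_apply, act_chordDelta hpq t G hp, h, structureConst_swap]
  simp

/-- Acting at one end of a chord replaces its delta by a structure constant. Two such constants
share the index `t`, and contracting it reconnects the four endpoints. -/
theorem sum_act_act_chords {p q p' q' : ℕ} (h : [p, q, p', q'].Nodup) (G : (ℕ → Fin 3) → ℂ)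
    (hp : ∀ κ l, G (Function.update κ p l) = G κ) (hp' : ∀ κ l, G (Function.update κ p' l) = G κ)
    (κ : ℕ → Fin 3) :
    ∑ t, act t p' (act t p
      (fun κ => chordDelta s(p, q) κ * (chordDelta s(p', q') κ * G κ))) κ =
      chordDelta s(p, q') κ * (chordDelta s(p', q) κ * G κ) -
      chordDelta s(p, p') κ * (chordDelta s(q, q') κ * G κ) := by
  simp only [List.nodup_cons, List.mem_cons, not_or, List.not_mem_nil, not_false_eq_true] at h
  obtain ⟨⟨h1, h2, h3, -⟩, ⟨h4, h5, -⟩, ⟨h6, -⟩, -⟩ := h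
  have e : ∀ t, act t p (fun κ => chordDelta s(p, q) κ * (chordDelta s(p', q') κ * G κ)) =
      fun κ => chordDelta s(p', q') κ * (structureConst t (κ p) (κ q) * G κ) := by
    intro t
    funext κ
    rw [act_chordDelta h1 t (fun κ => chordDelta s(p', q') κ * G κ)]
    · ring
    · intro κ l
      rw [hp, chordDelta_update (by simp [h2, h3])]
  have e2 : ∀ t, act t p' (fun κ => chordDelta s(p', q') κ *
      (structureConst t (κ p) (κ q) * G κ)) κ =
      structureConst t (κ p') (κ q') * (structureConst t (κ p) (κ q) * G κ) := by
    intro t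
    rw [act_chordDelta h6 t (fun κ => structureConst t (κ p) (κ q) * G κ)]
    intro κ l
    rw [hp', Function.update_of_ne h2, Function.update_of_ne h4]
  have e3 : ∀ t, act t p' (act t p
      (fun κ => chordDelta s(p, q) κ * (chordDelta s(p', q') κ * G κ))) κ =
      structureConst t (κ p') (κ q') * structureConst t (κ p) (κ q) * G κ := by
    intro t
    rw [e, e2, mul_assoc]
  rw [Finset.sum_congr rfl fun t _ => e3 t, ← Finset.sum_mul, sum_structureConst_mul]
  simp only [chordDelta_mk, ← mul_assoc]
  rw [← sub_mul]
  congr 1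
  clear e e2 e3
  by_cases a1 : κ p' = κ q <;> by_cases a2 : κ q' = κ p <;> by_cases a3 : κ p' = κ p <;>
    by_cases a4 : κ q' = κ q <;> simp_all [eq_comm]
end
/-! ### Combinatorics of chord diagrams -/

theorem mem_points {D : Finset (Sym2 ℕ)} {p : ℕ} : p ∈ points D ↔ ∃ c ∈ D, p ∈ c := by
  simp [points]

theorem points_insert (c : Sym2 ℕ) (D : Finset (Sym2 ℕ)) :
    points (insert c D) = c.toFinset ∪ points D := by
  simp [points, Finset.biUnion_insert]

theorem mem_points_insert {p q r : ℕ} {D : Finset (Sym2 ℕ)} :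
    r ∈ points (insert s(p, q) D) ↔ r = p ∨ r = q ∨ r ∈ points D := by
  simp [points_insert, or_assoc]

theorem notMem_of_notMem_points {p q : ℕ} {D : Finset (Sym2 ℕ)} (h : p ∉ points D) :
    s(p, q) ∉ D := fun hc => h (mem_points.2 ⟨_, hc, Sym2.mem_mk_left _ _⟩)

theorem IsChordDiagram.subset {D D' : Finset (Sym2 ℕ)} (h : IsChordDiagram D) (hD : D' ⊆ D) :
    IsChordDiagram D' :=
  ⟨fun c hc => h.1 c (hD hc), fun c hc d hd => h.2 c (hD hc) d (hD hd)⟩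

theorem isChordDiagram_insert {p q : ℕ} {D : Finset (Sym2 ℕ)} (h : s(p, q) ∉ D) :
    IsChordDiagram (insert s(p, q) D) ↔
      p ≠ q ∧ IsChordDiagram D ∧ p ∉ points D ∧ q ∉ points D := by
  constructor
  · intro H
    refine ⟨?_, H.subset (Finset.subset_insert _ _), ?_, ?_⟩
    · simpa using H.1 _ (Finset.mem_insert_self _ _)
    · intro hp
      obtain ⟨c, hc, hpc⟩ := mem_points.1 hp
      exact H.2 _ (Finset.mem_insert_self _ _) c (Finset.mem_insert_of_mem hc)
        (by rintro rfl; exact h hc) p (Sym2.mem_mk_left _ _) hpc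
    · intro hp
      obtain ⟨c, hc, hpc⟩ := mem_points.1 hp
      exact H.2 _ (Finset.mem_insert_self _ _) c (Finset.mem_insert_of_mem hc)
        (by rintro rfl; exact h hc) q (Sym2.mem_mk_right _ _) hpc
  · rintro ⟨hpq, hD, hp, hq⟩
    have key : ∀ c ∈ D, ∀ r, r ∈ s(p, q) → r ∉ c := by
      intro c hc r hr hrc
      rcases Sym2.mem_iff.1 hr with rfl | rfl
      · exact hp (mem_points.2 ⟨c, hc, hrc⟩)
      · exact hq (mem_points.2 ⟨c, hc, hrc⟩)
    constructor
    · intro c hc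
      rcases Finset.mem_insert.1 hc with rfl | hc
      · simpa using hpq
      · exact hD.1 c hc
    · intro c hc d hd hcd r hrc hrd
      rcases Finset.mem_insert.1 hc with rfl | hc <;> rcases Finset.mem_insert.1 hd with rfl | hd
      · exact hcd rfl
      · exact key d hd r hrc hrd
      · exact key c hc r hrd hrc
      · exact hD.2 c hc d hd hcd r hrc hrd

theorem IsChordDiagram.eq_of_mem {D : Finset (Sym2 ℕ)} (h : IsChordDiagram D) {c d : Sym2 ℕ}
    (hc : c ∈ D) (hd : d ∈ D) {p : ℕ} (hpc : p ∈ c) (hpd : p ∈ d) : c = d := by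
  by_contra hcd
  exact h.2 c hc d hd hcd p hpc hpd

theorem IsChordDiagram.partner_unique {D : Finset (Sym2 ℕ)} (h : IsChordDiagram D) {p q r : ℕ}
    (hq : s(p, q) ∈ D) (hr : s(p, r) ∈ D) : q = r :=
  Sym2.congr_right.1 (h.eq_of_mem hq hr (Sym2.mem_mk_left p q) (Sym2.mem_mk_left p r))

theorem IsChordDiagram.ne {D : Finset (Sym2 ℕ)} (h : IsChordDiagram D) {p q : ℕ}
    (hq : s(p, q) ∈ D) : p ≠ q := by simpa using h.1 _ hq

theorem exists_partner {D : Finset (Sym2 ℕ)} {p : ℕ} (hp : p ∈ points D) : ∃ q, s(p, q) ∈ D := by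
  obtain ⟨c, hc, hpc⟩ := mem_points.1 hp
  obtain ⟨q, rfl⟩ := Sym2.mem_iff_exists.1 hpc
  exact ⟨q, hc⟩

/-- Remove two chords from a chord diagram. -/
theorem IsChordDiagram.exists_eq_insert_insert {D : Finset (Sym2 ℕ)} (h : IsChordDiagram D)
    {p q p' q' : ℕ} (hc : s(p, q) ∈ D) (hd : s(p', q') ∈ D) (hcd : s(p, q) ≠ s(p', q')) :
    [p, q, p', q'].Nodup ∧ ∃ E, E = (D.erase s(p, q)).erase s(p', q') ∧
      D = insert s(p, q) (insert s(p', q') E) ∧ E ⊆ D ∧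
      ∀ r ∈ [p, q, p', q'], r ∉ points E := by
  have key : ∀ r, r ∈ s(p, q) → r ∉ s(p', q') := h.2 _ hc _ hd hcd
  have h1 := h.ne hc
  have h2 := h.ne hd
  have k1 := key p (Sym2.mem_mk_left _ _)
  have k2 := key q (Sym2.mem_mk_right _ _)
  simp only [Sym2.mem_iff, not_or] at k1 k2
  refine ⟨by simp [h1, h2, k1, k2], _, rfl, ?_, ?_, ?_⟩
  · rw [Finset.insert_erase (Finset.mem_erase.2 ⟨hcd.symm, hd⟩), Finset.insert_erase hc]
  · exact (Finset.erase_subset _ _).trans (Finset.erase_subset _ _)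
  · intro r hr hrE
    obtain ⟨e, he, hre⟩ := mem_points.1 hrE
    simp only [Finset.mem_erase] at he
    simp only [List.mem_cons, List.not_mem_nil, or_false] at hr
    rcases hr with rfl | rfl | rfl | rfl
    · exact he.2.1 (h.eq_of_mem he.2.2 hc hre (Sym2.mem_mk_left _ _))
    · exact he.2.1 (h.eq_of_mem he.2.2 hc hre (Sym2.mem_mk_right _ _))
    · exact he.1 (h.eq_of_mem he.2.2 hd hre (Sym2.mem_mk_left _ _))
    · exact he.1 (h.eq_of_mem he.2.2 hd hre (Sym2.mem_mk_right _ _))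

theorem diagramDelta_update_of_notMem_points {D : Finset (Sym2 ℕ)} {p : ℕ} (hp : p ∉ points D)
    (κ : ℕ → Fin 3) (l : Fin 3) :
    diagramDelta D (Function.update κ p l) = diagramDelta D κ :=
  diagramDelta_update (fun c hc hpc => hp (mem_points.2 ⟨c, hc, hpc⟩)) κ l

/-- Two chords with four new endpoints can be added to a chord diagram. -/
theorem insert_insert_facts {E : Finset (Sym2 ℕ)} {p q p' q' : ℕ} (hE : IsChordDiagram E)
    (hn : [p, q, p', q'].Nodup) (hr : ∀ r ∈ [p, q, p', q'], r ∉ points E) :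
    IsChordDiagram (insert s(p, q) (insert s(p', q') E)) ∧
      (insert s(p, q) (insert s(p', q') E)).card = E.card + 2 ∧
      (∀ r, r ∈ points (insert s(p, q) (insert s(p', q') E)) ↔
        r ∈ [p, q, p', q'] ∨ r ∈ points E) ∧
      ∀ κ, diagramDelta (insert s(p, q) (insert s(p', q') E)) κ =
        chordDelta s(p, q) κ * (chordDelta s(p', q') κ * diagramDelta E κ) := by
  simp only [List.mem_cons, List.not_mem_nil, or_false, forall_eq_or_imp, forall_eq] at hr
  simp only [List.nodup_cons, List.mem_cons, not_or, List.not_mem_nil, not_false_eq_true,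
    List.nodup_nil, and_true] at hn
  have h2 : s(p', q') ∉ E := notMem_of_notMem_points hr.2.2.1
  have h1 : p ∉ points (insert s(p', q') E) := by simp [mem_points_insert, hn, hr]
  have h1' : q ∉ points (insert s(p', q') E) := by simp [mem_points_insert, hn, hr]
  have h3 := notMem_of_notMem_points (q := q) h1
  refine ⟨(isChordDiagram_insert h3).2 ⟨hn.1.1, (isChordDiagram_insert h2).2
    ⟨hn.2.2, hE, hr.2.2.1, hr.2.2.2⟩, h1, h1'⟩, ?_, ?_, ?_⟩
  · rw [Finset.card_insert_of_notMem h3, Finset.card_insert_of_notMem h2]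
  · intro r
    simp [mem_points_insert, or_assoc]
  · intro κ
    rw [diagramDelta_insert h3, diagramDelta_insert h2]

/-! ### The value of a chord diagram -/

variable {A : Type*} [Ring A] [Algebra ℂ A] (R : Sl2Trace A)

/-- The product of the basis elements given by the colors of the points of a list. -/
def Sl2Trace.word (L : List ℕ) (κ : ℕ → Fin 3) : A := (L.map fun p => R.J (κ p)).prod

theorem Sl2Trace.word_append (L L' : List ℕ) (κ : ℕ → Fin 3) :
    R.word (L ++ L') κ = R.word L κ * R.word L' κ := by simp [Sl2Trace.word]

theorem Sl2Trace.word_cons (p : ℕ) (L : List ℕ) (κ : ℕ → Fin 3) :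
    R.word (p :: L) κ = R.J (κ p) * R.word L κ := by simp [Sl2Trace.word]

theorem Sl2Trace.word_congr {L : List ℕ} {κ κ' : ℕ → Fin 3} (h : ∀ p ∈ L, κ p = κ' p) :
    R.word L κ = R.word L κ' := by
  unfold Sl2Trace.word
  rw [List.map_congr_left fun p hp => by rw [h p hp]]

theorem Sl2Trace.word_update {L : List ℕ} {p : ℕ} (h : p ∉ L) (κ : ℕ → Fin 3) (l : Fin 3) :
    R.word L (Function.update κ p l) = R.word L κ :=
  R.word_congr fun q hq => Function.update_of_ne (by rintro rfl; exact h hq) _ _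

/-- The value of the set of chords `D` on the points listed in `L` in the order in which they are
met on the circle. -/
noncomputable def Sl2Trace.val (L : List ℕ) (D : Finset (Sym2 ℕ)) : ℂ :=
  colorSumList L (fun κ => diagramDelta D κ * R.tr (R.word L κ)) 0

/-- Cyclicity of the trace makes the base point of the circle irrelevant. -/
theorem Sl2Trace.val_rotate (L L' : List ℕ) (D : Finset (Sym2 ℕ)) :
    R.val (L ++ L') D = R.val (L' ++ L) D := by
  unfold Sl2Trace.val
  rw [colorSumList_perm List.perm_append_comm]
  simp only [R.word_append, R.tr_mul_comm (R.word L _)]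

theorem Sl2Trace.val_isRotated {L L' : List ℕ} (h : L ~r L') (D : Finset (Sym2 ℕ)) :
    R.val L D = R.val L' D := by
  obtain ⟨n, rfl⟩ := h
  rw [List.rotate_eq_drop_append_take_mod, R.val_rotate, List.take_append_drop]

theorem Sl2Trace.val_map {f : ℕ → ℕ} {L : List ℕ} {D : Finset (Sym2 ℕ)}
    (hf : Set.InjOn f {p | p ∈ L}) (hD : ∀ p ∈ points D, p ∈ L) :
    R.val (L.map f) (D.image (Sym2.map f)) = R.val L D := by
  refine colorSumList_map L [] (by simpa using hf) ?_ _ _ (by simp)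
  intro κ κ' h
  replace h : ∀ p ∈ L, κ' (f p) = κ p := by simpa using h
  have hinj : Set.InjOn (Sym2.map f) D := by
    intro c hc d hd hcd
    induction c with | h a b =>
    induction d with | h a' b' =>
    have m : ∀ {p c}, c ∈ D → p ∈ c → p ∈ L := fun h1 h2 => hD _ (mem_points.2 ⟨_, h1, h2⟩)
    have ha := m hc (Sym2.mem_mk_left a b)
    have hb := m hc (Sym2.mem_mk_right a b)
    have ha' := m hd (Sym2.mem_mk_left a' b')
    have hb' := m hd (Sym2.mem_mk_right a' b')
    simp only [Sym2.map_mk, Sym2.eq_iff] at hcd ⊢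
    rcases hcd with ⟨h1, h2⟩ | ⟨h1, h2⟩
    · exact Or.inl ⟨hf ha ha' h1, hf hb hb' h2⟩
    · exact Or.inr ⟨hf ha hb' h1, hf hb ha' h2⟩
  congr 1
  · unfold diagramDelta
    rw [Finset.prod_image hinj]
    refine Finset.prod_congr rfl fun c hc => ?_
    induction c with | h a b =>
    have ha : a ∈ L := hD _ (mem_points.2 ⟨_, hc, Sym2.mem_mk_left a b⟩)
    have hb : b ∈ L := hD _ (mem_points.2 ⟨_, hc, Sym2.mem_mk_right a b⟩)
    simp only [Sym2.map_mk, chordDelta_mk, h a ha, h b hb]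
  · congr 1
    unfold Sl2Trace.word
    rw [List.map_map]
    congr 1
    exact List.map_congr_left fun p hp => by simp [h p hp]

theorem Sl2Trace.val_insert {p q : ℕ} {L Q : List ℕ} {D : Finset (Sym2 ℕ)}
    (hL : (p :: L ++ q :: Q).Nodup) (hp : p ∉ points D) (hq : q ∉ points D) :
    R.val (p :: L ++ q :: Q) (insert s(p, q) D) =
      colorSumList (L ++ Q) (fun κ => diagramDelta D κ *
        ∑ t, R.tr (R.J t * R.word L κ * R.J t * R.word Q κ)) 0 := by
  have hperm : (p :: L ++ q :: Q).Perm ((L ++ Q) ++ [p, q]) := by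
    have h1 : (p :: L ++ q :: Q).Perm (p :: q :: (L ++ Q)) := List.perm_middle.cons p
    exact h1.trans (List.perm_append_comm (l₁ := [p, q]))
  have hne : p ≠ q ∧ p ∉ L ∧ p ∉ Q ∧ q ∉ L ∧ q ∉ Q := by
    have := hperm.nodup_iff.1 hL
    simp only [List.nodup_append, List.nodup_cons, List.mem_append, List.mem_cons,
      List.not_mem_nil, or_false] at this
    grind
  obtain ⟨hpq, hpL, hpQ, hqL, hqQ⟩ := hne
  unfold Sl2Trace.val
  rw [colorSumList_perm hperm, colorSumList_append]
  congr 1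
  funext κ
  simp only [colorSumList_cons, colorSumList_nil, colorSum,
    diagramDelta_insert (notMem_of_notMem_points hp), R.word_append, R.word_cons,
    R.word_update hpL, R.word_update hpQ, R.word_update hqL, R.word_update hqQ,
    diagramDelta_update_of_notMem_points hp, diagramDelta_update_of_notMem_points hq,
    chordDelta_mk, Function.update_self, Function.update_of_ne hpq, Finset.mul_sum]
  refine Finset.sum_congr rfl fun t _ => ?_
  simp [mul_assoc]

/-- Expand `[J,[J,P]] = J²P + PJ² - 2JPJ` and use that the Casimir element is a scalar. -/
theorem Sl2Trace.sum_tr_mul_mul (P Q : A) :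
    ∑ t, R.tr (R.J t * P * R.J t * Q) = R.x * R.tr (P * Q) -
      1 / 2 * ∑ t, R.tr ((R.J t * (R.J t * P - P * R.J t) -
        (R.J t * P - P * R.J t) * R.J t) * Q) := by
  have h1 : ∑ t, R.tr (R.J t * R.J t * P * Q) = R.x * R.tr (P * Q) := by
    rw [← map_sum, ← Finset.sum_mul, ← Finset.sum_mul, R.casimir]
    simp
  have h2 : ∑ t, R.tr (P * (R.J t * R.J t) * Q) = R.x * R.tr (P * Q) := by
    rw [← map_sum, ← Finset.sum_mul, ← Finset.mul_sum, R.casimir]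
    simp
  have h3 : ∀ t, R.tr ((R.J t * (R.J t * P - P * R.J t) -
        (R.J t * P - P * R.J t) * R.J t) * Q) = R.tr (R.J t * R.J t * P * Q) +
        R.tr (P * (R.J t * R.J t) * Q) - 2 * R.tr (R.J t * P * R.J t * Q) := by
    intro t
    have : (R.J t * (R.J t * P - P * R.J t) - (R.J t * P - P * R.J t) * R.J t) * Q =
      R.J t * R.J t * P * Q + P * (R.J t * R.J t) * Q - (R.J t * P * R.J t * Q +
        R.J t * P * R.J t * Q) := by noncomm_ring
    rw [this, map_sub, map_add, map_add]
    ring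
  simp only [h3, Finset.sum_sub_distrib, Finset.sum_add_distrib, h1, h2, ← Finset.mul_sum]
  ring

/-- The action of `sl₂` on a set of points. -/
noncomputable def actSet {M : Type*} [AddCommGroup M] [Module ℂ M] (t : Fin 3) (S : Finset ℕ) :
    ((ℕ → Fin 3) → M) →ₗ[ℂ] ((ℕ → Fin 3) → M) := ∑ p ∈ S, act t p

theorem actSet_apply {M : Type*} [AddCommGroup M] [Module ℂ M] (t : Fin 3) (S : Finset ℕ)
    (F : (ℕ → Fin 3) → M) : actSet t S F = ∑ p ∈ S, act t p F := by
  simp [actSet, LinearMap.sum_apply]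

theorem actSet_comp_linearMap {M N : Type*} [AddCommGroup M] [Module ℂ M] [AddCommGroup N]
    [Module ℂ N] (t : Fin 3) (S : Finset ℕ) (g : (ℕ → Fin 3) → M →ₗ[ℂ] N)
    (hg : ∀ p ∈ S, ∀ κ l, g (Function.update κ p l) = g κ) (F : (ℕ → Fin 3) → M) :
    actSet t S (fun κ => g κ (F κ)) = fun κ => g κ (actSet t S F κ) := by
  rw [actSet_apply, actSet_apply, Finset.sum_congr rfl fun p hp =>
    act_comp_linearMap t p g (hg p hp) F]
  funext κ
  simp

/-- On the word of `L` the action is the commutator with `J t`. What follows, multiplication by the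
word of `Q` and the trace, is linear and does not see the colors of `L`, so the action passes
through it. -/
theorem Sl2Trace.actSet_word {L Q : List ℕ} (hL : (L ++ Q).Nodup) (t : Fin 3) :
    actSet t L.toFinset (actSet t L.toFinset (fun κ => R.tr (R.word (L ++ Q) κ))) = fun κ =>
      R.tr ((R.J t * (R.J t * R.word L κ - R.word L κ * R.J t) -
        (R.J t * R.word L κ - R.word L κ * R.J t) * R.J t) * R.word Q κ) := by
  let g : (ℕ → Fin 3) → A →ₗ[ℂ] ℂ := fun κ => R.tr ∘ₗ LinearMap.mulRight ℂ (R.word Q κ)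
  have hg : ∀ p ∈ L.toFinset, ∀ κ l, g (Function.update κ p l) = g κ := by
    intro p hp κ l
    simp only [g]
    rw [R.word_update]
    intro hpQ
    exact (List.nodup_append.1 hL).2.2 p (by simpa using hp) p hpQ rfl
  have h1 : (fun κ => R.tr (R.word (L ++ Q) κ)) = fun κ => g κ (R.word L κ) := by
    funext κ
    simp [g, R.word_append]
  let ad : A →ₗ[ℂ] A := LinearMap.mulLeft ℂ (R.J t) - LinearMap.mulRight ℂ (R.J t)
  have h2 : actSet t L.toFinset (fun κ => R.word L κ) = fun κ => ad (R.word L κ) := by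
    rw [actSet_apply]
    exact R.sum_act_prod t L (List.nodup_append.1 hL).1
  rw [h1, actSet_comp_linearMap t _ g hg, h2, actSet_comp_linearMap t _ g hg,
    actSet_comp_linearMap t _ (fun _ => ad) (fun _ _ _ _ => rfl), h2]
  rfl

theorem colorSumList_mul_actSet (t : Fin 3) {S : Finset ℕ} {L : List ℕ} (hS : ∀ p ∈ S, p ∈ L)
    (F G : (ℕ → Fin 3) → ℂ) (κ : ℕ → Fin 3) :
    colorSumList L (fun κ => F κ * actSet t S G κ) κ =
      -colorSumList L (fun κ => actSet t S F κ * G κ) κ := by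
  simp only [actSet_apply, Finset.sum_apply, Finset.mul_sum, Finset.sum_mul, colorSumList_sum]
  rw [← Finset.sum_neg_distrib]
  exact Finset.sum_congr rfl fun p hp => colorSumList_mul_act t (hS p hp) F G κ

/-- The recursion before the evaluation of the action on the tensor of the diagram. -/
theorem Sl2Trace.val_insert_eq_actSet {p q : ℕ} {L Q : List ℕ} {D : Finset (Sym2 ℕ)}
    (hL : (p :: L ++ q :: Q).Nodup) (hp : p ∉ points D) (hq : q ∉ points D) :
    R.val (p :: L ++ q :: Q) (insert s(p, q) D) = R.x * R.val (L ++ Q) D -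
      1 / 2 * colorSumList (L ++ Q) (fun κ =>
        (∑ t, actSet t L.toFinset (actSet t L.toFinset (diagramDelta D)) κ) *
          R.tr (R.word (L ++ Q) κ)) 0 := by
  have hLQ : (L ++ Q).Nodup := by
    have h1 : (p :: L ++ q :: Q).Perm (p :: q :: (L ++ Q)) := List.perm_middle.cons p
    exact (List.nodup_cons.1 (List.nodup_cons.1 (h1.nodup_iff.1 hL)).2).2
  rw [R.val_insert hL hp hq]
  have h1 : ∀ κ, diagramDelta D κ * ∑ t, R.tr (R.J t * R.word L κ * R.J t * R.word Q κ) =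
      R.x * (diagramDelta D κ * R.tr (R.word (L ++ Q) κ)) + (-(1 / 2)) * (∑ t, diagramDelta D κ *
        actSet t L.toFinset (actSet t L.toFinset (fun κ => R.tr (R.word (L ++ Q) κ))) κ) := by
    intro κ
    rw [R.sum_tr_mul_mul, ← Finset.mul_sum]
    simp only [R.actSet_word hLQ]
    rw [R.word_append]
    ring
  simp only [h1]
  rw [colorSumList_add, colorSumList_mul_left, colorSumList_mul_left, colorSumList_sum]
  simp only [Finset.sum_mul]
  rw [colorSumList_sum]
  have h2 : ∀ r ∈ L.toFinset, r ∈ L ++ Q := by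
    intro r hr
    simp [List.mem_toFinset.1 hr]
  -- The action is moved to the tensor of the diagram twice; the two signs cancel.
  simp only [colorSumList_mul_actSet _ h2]
  simp only [neg_neg]
  unfold Sl2Trace.val
  ring

/-! ### The recursion for the value of a chord diagram -/

/-- If `F` is invariant under the chords contained in `S`, only the points of `S` on chords that
leave `S` contribute to the action on `F`. -/
theorem actSet_eq_sum_crossing {D : Finset (Sym2 ℕ)} (hD : IsChordDiagram D) {S T : Finset ℕ}
    (hST : Disjoint S T) (hS : ∀ p, p ∈ points D ↔ p ∈ S ∨ p ∈ T) {Cr : Finset (ℕ × ℕ)}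
    (hCr : ∀ c, c ∈ Cr ↔ s(c.1, c.2) ∈ D ∧ c.1 ∈ S ∧ c.2 ∈ T) (t : Fin 3)
    (F : (ℕ → Fin 3) → ℂ)
    (hF : ∀ p ∈ S, ∀ q ∈ S, s(p, q) ∈ D → act t p F + act t q F = 0) :
    actSet t S F = ∑ c ∈ Cr, act t c.1 F := by
  rw [actSet_apply]
  have hinj : Set.InjOn Prod.fst (Cr : Set (ℕ × ℕ)) := by
    rintro ⟨p, q⟩ hc ⟨p', q'⟩ hd (rfl : p = p')
    exact Prod.ext rfl (hD.partner_unique ((hCr _).1 hc).1 ((hCr _).1 hd).1)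
  rw [← Finset.sum_image (g := Prod.fst) (f := fun p => act t p F) hinj]
  have hsub : Cr.image Prod.fst ⊆ S := by
    intro p hp
    obtain ⟨c, hc, rfl⟩ := Finset.mem_image.1 hp
    exact ((hCr c).1 hc).2.1
  rw [← Finset.sum_sdiff hsub, add_eq_right]
  have hpart : ∀ p ∈ S \ Cr.image Prod.fst, ∃ q, s(p, q) ∈ D ∧ q ∈ S \ Cr.image Prod.fst := by
    intro p hp
    rw [Finset.mem_sdiff] at hp
    obtain ⟨q, hq⟩ := exists_partner ((hS p).2 (Or.inl hp.1))
    have hqS : q ∈ S := by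
      refine ((hS q).1 (mem_points.2 ⟨_, hq, Sym2.mem_mk_right _ _⟩)).resolve_right fun hqT => ?_
      exact hp.2 (Finset.mem_image.2 ⟨(p, q), (hCr _).2 ⟨hq, hp.1, hqT⟩, rfl⟩)
    refine ⟨q, hq, Finset.mem_sdiff.2 ⟨hqS, fun hqI => ?_⟩⟩
    obtain ⟨⟨q', r⟩, hc, rfl⟩ := Finset.mem_image.1 hqI
    obtain ⟨h1, -, h3⟩ := (hCr _).1 hc
    rw [Sym2.eq_swap] at hq
    rw [hD.partner_unique h1 hq] at h3
    exact Finset.disjoint_left.1 hST hp.1 h3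
  choose! g hgD hgS using hpart
  -- The remaining points lie on chords inside `S`; exchanging the two ends of each chord is a
  -- fixed-point-free involution whose pairs cancel.
  refine Finset.sum_involution (fun p _ => g p) ?_ ?_ (fun p hp => hgS p hp) ?_
  · intro p hp
    exact hF p (Finset.mem_sdiff.1 hp).1 _ (Finset.mem_sdiff.1 (hgS p hp)).1 (hgD p hp)
  · intro p hp _
    exact (hD.ne (hgD p hp)).symm
  · intro p hp
    have h1 := hgD p hp
    rw [Sym2.eq_swap] at h1
    exact hD.partner_unique (hgD _ (hgS p hp)) h1

/-- After an action at `c.1` only the chord `c` has lost its invariance, and this chord leaves `S`.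
Chords inside `S` are still invariant because actions at distinct points commute, so they cancel in
the second action as well. -/
theorem actSet_diagramDelta {D : Finset (Sym2 ℕ)} (hD : IsChordDiagram D) {S T : Finset ℕ}
    (hST : Disjoint S T) (hS : ∀ p, p ∈ points D ↔ p ∈ S ∨ p ∈ T) {Cr : Finset (ℕ × ℕ)}
    (hCr : ∀ c, c ∈ Cr ↔ s(c.1, c.2) ∈ D ∧ c.1 ∈ S ∧ c.2 ∈ T) (t : Fin 3) :
    actSet t S (actSet t S (diagramDelta D)) =
      ∑ c ∈ Cr, ∑ d ∈ Cr, act t d.1 (act t c.1 (diagramDelta D)) := by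
  have h1 : ∀ p q, s(p, q) ∈ D →
      act t p (diagramDelta D) + act t q (diagramDelta D) = 0 := by
    intro p q hpq
    have hE : diagramDelta D = fun κ => chordDelta s(p, q) κ * diagramDelta (D.erase s(p, q)) κ := by
      funext κ
      rw [← diagramDelta_insert (Finset.notMem_erase _ _), Finset.insert_erase hpq]
    have hu : ∀ r ∈ s(p, q), ∀ κ l, diagramDelta (D.erase s(p, q)) (Function.update κ r l) =
        diagramDelta (D.erase s(p, q)) κ := by
      intro r hr κ l
      refine diagramDelta_update (fun c hc hrc => ?_) κ l
      rw [Finset.mem_erase] at hc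
      exact hc.1 (hD.eq_of_mem hc.2 hpq hrc hr)
    rw [hE]
    exact act_add_act_chord (hD.ne hpq) t _ (hu p (Sym2.mem_mk_left _ _))
      (hu q (Sym2.mem_mk_right _ _))
  rw [actSet_eq_sum_crossing hD hST hS hCr t (diagramDelta D) (fun p _ q _ h => h1 p q h), map_sum]
  refine Finset.sum_congr rfl fun c hc => ?_
  refine actSet_eq_sum_crossing hD hST hS hCr t _ fun p hp q hq hpq => ?_
  obtain ⟨hcD, hcS, hcT⟩ := (hCr c).1 hc
  have hpc : p ≠ c.1 := by
    rintro rfl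
    rw [hD.partner_unique hpq hcD] at hq
    exact Finset.disjoint_left.1 hST hq hcT
  have hqc : q ≠ c.1 := by
    rintro rfl
    rw [Sym2.eq_swap] at hpq
    rw [hD.partner_unique hpq hcD] at hp
    exact Finset.disjoint_left.1 hST hp hcT
  rw [act_comm hpc, act_comm hqc, ← map_add, h1 p q hpq, map_zero]

theorem sum_product_eq_of_symm (Cr : Finset (ℕ × ℕ)) (hinj : Set.InjOn Prod.fst (Cr : Set (ℕ × ℕ)))
    (f : ℕ × ℕ → ℕ × ℕ → ℂ) (hf : ∀ c ∈ Cr, ∀ d ∈ Cr, f c d = f d c) :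
    ∑ c ∈ Cr, ∑ d ∈ Cr, f c d = ∑ c ∈ Cr, f c c +
      2 * ∑ cd ∈ (Cr ×ˢ Cr).filter (fun cd => cd.1.1 < cd.2.1), f cd.1 cd.2 := by
  have h1 : ∀ c ∈ Cr, ∀ d ∈ Cr, f c d = (if c = d then f c d else 0) +
      ((if c.1 < d.1 then f c d else 0) + if d.1 < c.1 then f c d else 0) := by
    intro c hc d hd
    rcases lt_trichotomy c.1 d.1 with h | h | h
    · have : c ≠ d := by rintro rfl; exact lt_irrefl _ h
      simp [h, this, h.le]
    · simp [hinj hc hd h]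
    · have : c ≠ d := by rintro rfl; exact lt_irrefl _ h
      simp [h, this, h.le]
  have h2 : ∑ c ∈ Cr, ∑ d ∈ Cr, (if d.1 < c.1 then f c d else 0) =
      ∑ c ∈ Cr, ∑ d ∈ Cr, (if c.1 < d.1 then f c d else 0) := by
    rw [Finset.sum_comm]
    refine Finset.sum_congr rfl fun c hc => Finset.sum_congr rfl fun d hd => ?_
    rw [hf c hc d hd]
  rw [Finset.sum_congr rfl fun c hc => Finset.sum_congr rfl fun d hd => h1 c hc d hd]
  simp only [Finset.sum_add_distrib]
  rw [h2, Finset.sum_filter, Finset.sum_product, two_mul]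
  congr 1
  refine Finset.sum_congr rfl fun c hc => ?_
  simp [hc]

/-- `reconnectSame` and `reconnectCross` in terms of the chords that are left unchanged. -/
theorem reconnect_facts {D : Finset (Sym2 ℕ)} (hD : IsChordDiagram D) {a : Sym2 ℕ} {c d : ℕ × ℕ}
    (hc : s(c.1, c.2) ∈ D.erase a) (hd : s(d.1, d.2) ∈ D.erase a) (hn : c.1 ≠ d.1)
    (hn' : c.1 ≠ d.2) :
    ∃ E, IsChordDiagram E ∧ [c.1, c.2, d.1, d.2].Nodup ∧
      (∀ r ∈ [c.1, c.2, d.1, d.2], r ∉ points E) ∧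
      D.erase a = insert s(c.1, c.2) (insert s(d.1, d.2) E) ∧
      reconnectSame D a c d = insert s(c.1, d.1) (insert s(c.2, d.2) E) ∧
      reconnectCross D a c d = insert s(c.1, d.2) (insert s(d.1, c.2) E) := by
  have hD' : IsChordDiagram (D.erase a) := hD.subset (Finset.erase_subset _ _)
  obtain ⟨h1, E, hE, h2, h3, h4⟩ := hD'.exists_eq_insert_insert hc hd (fun h => by
    rcases Sym2.mem_iff.1 (h ▸ Sym2.mem_mk_left c.1 c.2 : c.1 ∈ s(d.1, d.2)) with h | h
    exacts [hn h, hn' h])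
  exact ⟨E, hD'.subset h3, h1, h4, h2, by rw [hE]; rfl, by rw [hE]; rfl⟩

theorem reconnect_isChordDiagram {D : Finset (Sym2 ℕ)} (hD : IsChordDiagram D) {a : Sym2 ℕ}
    {c d : ℕ × ℕ} (hc : s(c.1, c.2) ∈ D.erase a) (hd : s(d.1, d.2) ∈ D.erase a) (hn : c.1 ≠ d.1)
    (hn' : c.1 ≠ d.2) :
    (IsChordDiagram (reconnectSame D a c d) ∧ (reconnectSame D a c d).card = (D.erase a).card ∧
      points (reconnectSame D a c d) = points (D.erase a)) ∧
    (IsChordDiagram (reconnectCross D a c d) ∧ (reconnectCross D a c d).card = (D.erase a).card ∧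
      points (reconnectCross D a c d) = points (D.erase a)) := by
  obtain ⟨E, hE, h1, h2, h3, h4, h5⟩ := reconnect_facts hD hc hd hn hn'
  have k1 := insert_insert_facts hE h1 h2
  have k2 := insert_insert_facts (p := c.1) (q := d.1) (p' := c.2) (q' := d.2) hE (by grind)
    (by grind)
  have k3 := insert_insert_facts (p := c.1) (q := d.2) (p' := d.1) (q' := c.2) hE (by grind)
    (by grind)
  rw [h3, h4, h5]
  refine ⟨⟨k2.1, k2.2.1.trans k1.2.1.symm, ?_⟩, k3.1, k3.2.1.trans k1.2.1.symm, ?_⟩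
  · ext r
    rw [k1.2.2.1, k2.2.2.1]
    grind
  · ext r
    rw [k1.2.2.1, k3.2.2.1]
    grind

theorem Sl2Trace.val_recursion_list {p q : ℕ} {L Q : List ℕ} {D : Finset (Sym2 ℕ)}
    (hD : IsChordDiagram D) (hpq : s(p, q) ∈ D) (hL : (p :: L ++ q :: Q).Nodup)
    (hpts : ∀ r, r ∈ points D ↔ r ∈ p :: L ++ q :: Q) {Cr : Finset (ℕ × ℕ)}
    (hCr : ∀ c, c ∈ Cr ↔ s(c.1, c.2) ∈ D ∧ c.1 ∈ L ∧ c.2 ∈ Q) :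
    R.val (p :: L ++ q :: Q) D = (R.x - Cr.card) * R.val (L ++ Q) (D.erase s(p, q)) +
      ∑ cd ∈ (Cr ×ˢ Cr).filter (fun cd => cd.1.1 < cd.2.1),
        (R.val (L ++ Q) (reconnectSame D s(p, q) cd.1 cd.2) -
          R.val (L ++ Q) (reconnectCross D s(p, q) cd.1 cd.2)) := by
  set D' := D.erase s(p, q) with hD'def
  have hins : D = insert s(p, q) D' := (Finset.insert_erase hpq).symm
  have hD' : IsChordDiagram D' := hD.subset (Finset.erase_subset _ _)
  obtain ⟨hne, -, hp, hq⟩ := (isChordDiagram_insert (Finset.notMem_erase s(p, q) D)).1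
    (hins ▸ hD)
  rw [← hD'def] at hp hq
  have hLQ : (p :: q :: (L ++ Q)).Nodup := (List.perm_middle.cons p).nodup_iff.1 hL
  simp only [List.nodup_cons, List.mem_cons, not_or, List.mem_append, List.nodup_append] at hLQ
  obtain ⟨⟨-, hpL, hpQ⟩, ⟨hqL, hqQ⟩, -, -, hdisj⟩ := hLQ
  have hST : Disjoint L.toFinset Q.toFinset := by
    rw [Finset.disjoint_left]
    intro r hr hr'
    exact hdisj r (by simpa using hr) r (by simpa using hr') rfl
  have hS : ∀ r, r ∈ points D' ↔ r ∈ L.toFinset ∨ r ∈ Q.toFinset := by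
    intro r
    have h1 := hpts r
    rw [hins, mem_points_insert] at h1
    simp only [List.mem_toFinset]
    rcases eq_or_ne r p with rfl | h2
    · simp [hp, hpL, hpQ]
    rcases eq_or_ne r q with rfl | h3
    · simp [hq, hqL, hqQ]
    simpa [h2, h3] using h1
  have hCr' : ∀ c, c ∈ Cr ↔ s(c.1, c.2) ∈ D' ∧ c.1 ∈ L.toFinset ∧ c.2 ∈ Q.toFinset := by
    intro c
    rw [hCr, hD'def, Finset.mem_erase, List.mem_toFinset, List.mem_toFinset]
    constructor
    · rintro ⟨h1, h2, h3⟩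
      refine ⟨⟨?_, h1⟩, h2, h3⟩
      intro h
      rcases Sym2.mem_iff.1 (h ▸ Sym2.mem_mk_left c.1 c.2 : c.1 ∈ s(p, q)) with h | h
      · exact hpL (h ▸ h2)
      · exact hqL (h ▸ h2)
    · rintro ⟨h1, h2, h3⟩
      exact ⟨h1.2, h2, h3⟩
  have hinj : Set.InjOn Prod.fst (Cr : Set (ℕ × ℕ)) := by
    rintro ⟨r, s⟩ hc ⟨r', s'⟩ hd (rfl : r = r')
    exact Prod.ext rfl (hD.partner_unique ((hCr _).1 hc).1 ((hCr _).1 hd).1)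
  have hdelta : ∀ c ∈ Cr, ∀ d ∈ Cr, c.1 ≠ d.1 → ∀ κ,
      ∑ t, act t d.1 (act t c.1 (diagramDelta D')) κ =
        diagramDelta (reconnectCross D s(p, q) c d) κ -
        diagramDelta (reconnectSame D s(p, q) c d) κ := by
    intro c hc d hd hcd κ
    obtain ⟨hc1, hc2, hc3⟩ := (hCr' c).1 hc
    obtain ⟨hd1, hd2, hd3⟩ := (hCr' d).1 hd
    obtain ⟨E, hE, h1, h2, h3, h4, h5⟩ := reconnect_facts hD hc1 hd1 hcd
      (fun h => Finset.disjoint_left.1 hST hc2 (h ▸ hd3))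
    have k1 := insert_insert_facts hE h1 h2
    have k2 := insert_insert_facts (p := c.1) (q := d.1) (p' := c.2) (q' := d.2) hE (by grind)
      (by grind)
    have k3 := insert_insert_facts (p := c.1) (q := d.2) (p' := d.1) (q' := c.2) hE (by grind)
      (by grind)
    rw [h4, h5, k2.2.2.2, k3.2.2.2]
    rw [← hD'def] at h3
    have k4 : diagramDelta D' = fun κ =>
        chordDelta s(c.1, c.2) κ * (chordDelta s(d.1, d.2) κ * diagramDelta E κ) := by
      funext κ
      rw [h3, k1.2.2.2]
    rw [k4]
    exact sum_act_act_chords h1 (diagramDelta E)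
      (fun κ l => diagramDelta_update_of_notMem_points (h2 _ (by simp)) κ l)
      (fun κ l => diagramDelta_update_of_notMem_points (h2 _ (by simp)) κ l) κ
  -- The diagonal of the double sum over crossing chords gives the adjoint Casimir eigenvalue `2`
  -- for each chord; off the diagonal each unordered pair occurs twice. The prefactor `-1/2` turns
  -- this into `-k` and same minus cross.
  have hsum : ∀ κ, ∑ t, actSet t L.toFinset (actSet t L.toFinset (diagramDelta D')) κ =
      2 * Cr.card * diagramDelta D' κ +
      2 * ∑ cd ∈ (Cr ×ˢ Cr).filter (fun cd => cd.1.1 < cd.2.1),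
        (diagramDelta (reconnectCross D s(p, q) cd.1 cd.2) κ -
        diagramDelta (reconnectSame D s(p, q) cd.1 cd.2) κ) := by
    intro κ
    simp only [actSet_diagramDelta hD' hST hS hCr', Finset.sum_apply]
    rw [Finset.sum_comm]
    have h1 : ∀ c ∈ Cr, ∑ t, ∑ d ∈ Cr, act t d.1 (act t c.1 (diagramDelta D')) κ =
        ∑ d ∈ Cr, ∑ t, act t d.1 (act t c.1 (diagramDelta D')) κ := fun c _ => Finset.sum_comm
    rw [Finset.sum_congr rfl h1, sum_product_eq_of_symm Cr hinj]
    · congr 1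
      · have h2 : ∀ c ∈ Cr, ∑ t, act t c.1 (act t c.1 (diagramDelta D')) κ =
            2 * diagramDelta D' κ := by
          intro c _
          have := congrFun (sum_act_act c.1 (diagramDelta D')) κ
          rw [Finset.sum_apply] at this
          rw [this]
          rfl
        rw [Finset.sum_congr rfl h2, Finset.sum_const, nsmul_eq_mul]
        ring
      · congr 1
        refine Finset.sum_congr rfl fun cd hcd => ?_
        simp only [Finset.mem_filter, Finset.mem_product] at hcd
        exact hdelta _ hcd.1.1 _ hcd.1.2 hcd.2.ne κ
    · intro c hc d hd
      refine Finset.sum_congr rfl fun t _ => ?_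
      rcases eq_or_ne c.1 d.1 with h | h
      · rw [h]
      · rw [act_comm h]
  rw [hins, R.val_insert_eq_actSet hL hp hq]
  rw [← hins]
  have h3 : ∀ κ, (∑ t, actSet t L.toFinset (actSet t L.toFinset (diagramDelta D')) κ) *
      R.tr (R.word (L ++ Q) κ) = 2 * Cr.card * (diagramDelta D' κ * R.tr (R.word (L ++ Q) κ)) +
      (-2) * ∑ cd ∈ (Cr ×ˢ Cr).filter (fun cd => cd.1.1 < cd.2.1),
        (diagramDelta (reconnectSame D s(p, q) cd.1 cd.2) κ * R.tr (R.word (L ++ Q) κ) +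
        (-1) * (diagramDelta (reconnectCross D s(p, q) cd.1 cd.2) κ *
          R.tr (R.word (L ++ Q) κ))) := by
    intro κ
    rw [hsum, add_mul, mul_assoc 2 (∑ _ ∈ _, _), Finset.sum_mul, Finset.mul_sum, Finset.mul_sum,
      mul_assoc (2 * (Cr.card : ℂ))]
    congr 1
    exact Finset.sum_congr rfl fun cd _ => by ring
  simp only [h3]
  rw [colorSumList_add, colorSumList_mul_left, colorSumList_mul_left, colorSumList_sum]
  simp only [colorSumList_add, colorSumList_mul_left]
  unfold Sl2Trace.val
  simp only [neg_one_mul, ← sub_eq_add_neg]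
  ring

/-! ### The value of a diagram on the circle -/

/-- The value of a diagram, its points being met in increasing order. -/
noncomputable def Sl2Trace.diagramVal (D : Finset (Sym2 ℕ)) : ℂ := R.val (points D).sort D

theorem sort_points_eq {D : Finset (Sym2 ℕ)} {L : List ℕ} (hL : L.Pairwise (· < ·))
    (h : ∀ p, p ∈ L ↔ p ∈ points D) : (points D).sort = L :=
  (Finset.sortedLT_sort _).eq_of_mem_iff hL.sortedLT (by simp [h])

/-- The circle is rotated so that it starts at the smaller endpoint of `a`. The points strictly
between the endpoints are then the first block, which is the side used in `crossing`, and the rest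
form the second block. -/
theorem Sl2Trace.diagramVal_recursion {D : Finset (Sym2 ℕ)} (hD : IsChordDiagram D) {a : Sym2 ℕ}
    (ha : a ∈ D) :
    R.diagramVal D = (R.x - (crossing D a).card) * R.diagramVal (D.erase a) +
      ∑ cd ∈ (crossing D a ×ˢ crossing D a).filter (fun cd => cd.1.1 < cd.2.1),
        (R.diagramVal (reconnectSame D a cd.1 cd.2) -
          R.diagramVal (reconnectCross D a cd.1 cd.2)) := by
  obtain ⟨p, q, hpq, rfl⟩ : ∃ p q, p < q ∧ a = s(p, q) := by
    induction a with | h p q =>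
    rcases lt_trichotomy p q with h | h | h
    · exact ⟨p, q, h, rfl⟩
    · exact absurd h (hD.ne ha)
    · exact ⟨q, p, h, Sym2.eq_swap⟩
  have hsort : ((points D).sort).Pairwise (· < ·) := (Finset.sortedLT_sort _).pairwise
  have hmem : ∀ r, r ∈ (points D).sort ↔ r ∈ points D := fun r => Finset.mem_sort _
  have hp : p ∈ (points D).sort := (hmem p).2 (mem_points.2 ⟨_, ha, Sym2.mem_mk_left _ _⟩)
  have hq : q ∈ (points D).sort := (hmem q).2 (mem_points.2 ⟨_, ha, Sym2.mem_mk_right _ _⟩)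
  obtain ⟨L₁, M, hM⟩ := List.append_of_mem hp
  rw [hM] at hsort
  have hqM : q ∈ M := by
    rw [hM, List.mem_append, List.mem_cons] at hq
    rcases hq with hq | rfl | hq
    · have := (List.pairwise_append.1 hsort).2.2 q hq p (by simp)
      omega
    · omega
    · exact hq
  obtain ⟨L₂, L₃, rfl⟩ := List.append_of_mem hqM
  have hsort' := hsort
  simp only [List.pairwise_append, List.pairwise_cons, List.mem_cons, List.mem_append,
    forall_eq_or_imp] at hsort
  obtain ⟨s1, ⟨s2, s3, ⟨s4, s5⟩, s6⟩, s7⟩ := hsort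
  have hrot : L₁ ++ p :: (L₂ ++ q :: L₃) ~r p :: L₂ ++ q :: (L₃ ++ L₁) := by
    have := List.isRotated_append (l := L₁) (l' := p :: (L₂ ++ q :: L₃))
    simpa using this
  have hE : points (D.erase s(p, q)) = (points D).filter (fun r => r ≠ p ∧ r ≠ q) := by
    have h1 := isChordDiagram_insert (Finset.notMem_erase s(p, q) D)
    rw [Finset.insert_erase ha] at h1
    obtain ⟨-, -, h2, h3⟩ := h1.1 hD
    ext r
    have h4 := mem_points_insert (p := p) (q := q) (r := r) (D := D.erase s(p, q))
    rw [Finset.insert_erase ha] at h4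
    rw [Finset.mem_filter, h4]
    constructor
    · intro h
      exact ⟨Or.inr (Or.inr h), by rintro rfl; exact h2 h, by rintro rfl; exact h3 h⟩
    · rintro ⟨h | h | h, h5, h6⟩
      exacts [absurd h h5, absurd h h6, h]
  have hE' : (points (D.erase s(p, q))).sort = L₁ ++ (L₂ ++ L₃) := by
    apply sort_points_eq
    · refine hsort'.sublist ?_
      exact List.Sublist.append (List.Sublist.refl _) ((List.Sublist.append (List.Sublist.refl _)
        (List.sublist_cons_self _ _)).cons _)
    · intro r
      rw [hE, Finset.mem_filter, ← hmem, hM]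
      simp only [List.mem_append, List.mem_cons]
      grind
  have hrot' : L₁ ++ (L₂ ++ L₃) ~r L₂ ++ (L₃ ++ L₁) := by
    have := List.isRotated_append (l := L₁) (l' := L₂ ++ L₃)
    simpa using this
  have hval : ∀ E, points E = points (D.erase s(p, q)) →
      R.diagramVal E = R.val (L₂ ++ (L₃ ++ L₁)) E := by
    intro E h
    unfold Sl2Trace.diagramVal
    rw [h, hE', R.val_isRotated hrot']
  have hCr : ∀ c, c ∈ crossing D s(p, q) ↔ s(c.1, c.2) ∈ D ∧ c.1 ∈ L₂ ∧ c.2 ∈ L₃ ++ L₁ := by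
    intro c
    simp only [crossing, Finset.mem_filter, Finset.mem_product, Sym2.inf_mk, Sym2.sup_mk,
      inf_eq_left.2 hpq.le, sup_eq_right.2 hpq.le]
    rw [← hmem, ← hmem, hM]
    simp only [List.mem_append, List.mem_cons]
    constructor
    · rintro ⟨⟨h1, h2⟩, h3, h4, h5⟩
      grind
    · rintro ⟨h1, h2, h3⟩
      grind
  have hnd : (p :: L₂ ++ q :: (L₃ ++ L₁)).Nodup := by
    rw [← hrot.nodup_iff, ← hM]
    exact Finset.sort_nodup _ _
  have hrec := R.val_recursion_list hD ha hnd
    (fun r => by rw [← hmem, hM]; exact hrot.mem_iff) hCr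
  unfold Sl2Trace.diagramVal at hval ⊢
  rw [hM, R.val_isRotated hrot, hrec, hval _ rfl]
  congr 1
  refine Finset.sum_congr rfl fun cd hcd => ?_
  simp only [Finset.mem_filter, Finset.mem_product, hCr] at hcd
  obtain ⟨⟨⟨h1, h2, h3⟩, h4, h5, h6⟩, h7⟩ := hcd
  have hmE : ∀ r s : ℕ, s(r, s) ∈ D → r ∈ L₂ → s(r, s) ∈ D.erase s(p, q) := by
    intro r s h hr
    refine Finset.mem_erase.2 ⟨fun h' => ?_, h⟩
    rcases Sym2.mem_iff.1 (h' ▸ Sym2.mem_mk_left r s : r ∈ s(p, q)) with rfl | rfl <;> grind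
  have hrc := reconnect_isChordDiagram hD (hmE _ _ h1 h2) (hmE _ _ h4 h5) h7.ne (by grind)
  rw [hval _ hrc.1.2.2, hval _ hrc.2.2.2]

theorem mem_crossing_facts {D : Finset (Sym2 ℕ)} {a : Sym2 ℕ}
    {c d : ℕ × ℕ} (hc : c ∈ crossing D a) (hd : d ∈ crossing D a) (hcd : c.1 < d.1) :
    s(c.1, c.2) ∈ D.erase a ∧ s(d.1, d.2) ∈ D.erase a ∧ c.1 ≠ d.1 ∧ c.1 ≠ d.2 := by
  simp only [crossing, Finset.mem_filter, Finset.mem_product] at hc hd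
  refine ⟨Finset.mem_erase.2 ⟨?_, hc.2.1⟩, Finset.mem_erase.2 ⟨?_, hd.2.1⟩, hcd.ne, by omega⟩
  · rintro rfl
    have h1 := hc.2.2.1
    simp only [Sym2.inf_mk, Sym2.sup_mk] at h1
    grind
  · rintro rfl
    have h1 := hd.2.2.1
    simp only [Sym2.inf_mk, Sym2.sup_mk] at h1
    grind

theorem Sl2Trace.aeval_recursionRHS {φ : Finset (Sym2 ℕ) → ℤ[X]} {D : Finset (Sym2 ℕ)}
    (hD : IsChordDiagram D) {a : Sym2 ℕ} (ha : a ∈ D)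
    (hφ : ∀ E, IsChordDiagram E → E.card + 1 = D.card → aeval R.x (φ E) = R.diagramVal E) :
    aeval R.x (recursionRHS φ D a) = R.diagramVal D := by
  have hcard := Finset.card_erase_add_one ha
  rw [R.diagramVal_recursion hD ha]
  simp only [recursionRHS, map_add, map_mul, map_sub, aeval_X, map_natCast, map_sum]
  rw [hφ _ (hD.subset (Finset.erase_subset _ _)) hcard]
  congr 1
  refine Finset.sum_congr rfl fun cd hcd => ?_
  simp only [Finset.mem_filter, Finset.mem_product] at hcd
  obtain ⟨h1, h2, h3, h4⟩ := mem_crossing_facts hcd.1.1 hcd.1.2 hcd.2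
  have hrc := reconnect_isChordDiagram hD h1 h2 h3 h4
  rw [hφ _ hrc.1.1 (by rw [hrc.1.2.1, hcard]), hφ _ hrc.2.1 (by rw [hrc.2.2.1, hcard])]

/-- The weight of a diagram, evaluated at the eigenvalue of the Casimir element. -/
theorem Sl2Trace.aeval_weight {D : Finset (Sym2 ℕ)} (hD : IsChordDiagram D) :
    aeval R.x (weight D) = R.diagramVal D := by
  unfold weight
  generalize hn : D.card = n
  induction n generalizing D with
  | zero =>
    rw [Finset.card_eq_zero] at hn
    subst hn
    simp [weightAux, Sl2Trace.diagramVal, Sl2Trace.val, points, diagramDelta, Sl2Trace.word,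
      R.tr_one]
  | succ n ih =>
    have hne : D.Nonempty := by rw [← Finset.card_pos]; omega
    simp only [weightAux, hne, dif_pos]
    -- The trace value satisfies the recursion along every chord, so the arbitrary choice in
    -- `weightAux` does not matter.
    refine R.aeval_recursionRHS hD (Exists.choose_spec hne) fun E hE hcard => ?_
    exact ih hE (by omega)

/-! ### Invariance under relabelling -/

/-- Rotate `L` to start at the point `m` with the smallest image. For later points `p`, `q` in this
order, `m, p, q` is cyclically ordered, and since `f m` is below both `f p` and `f q`, this forces
`f p < f q`. Hence the rotated image is strictly increasing and is `L'`. -/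
theorem CyclicallyOrdered.map_isRotated {f : ℕ → ℕ} {L L' : List ℕ} (hL : L.Pairwise (· < ·))
    (hL' : L'.Pairwise (· < ·)) (hf : Set.InjOn f {p | p ∈ L})
    (hmem : ∀ r, r ∈ L' ↔ r ∈ L.map f)
    (hc : ∀ p ∈ L, ∀ q ∈ L, ∀ r ∈ L, CyclicallyOrdered p q r →
      CyclicallyOrdered (f p) (f q) (f r)) : L.map f ~r L' := by
  rcases eq_or_ne L [] with rfl | hne
  · have : L' = [] := List.eq_nil_iff_forall_not_mem.2 fun r hr => by simpa using (hmem r).1 hr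
    simp [this]
  · obtain ⟨m, hm, hmin⟩ := Finset.exists_min_image L.toFinset f
      ((List.toFinset_nonempty_iff L).2 hne)
    clear hne
    rw [List.mem_toFinset] at hm
    obtain ⟨S, T, rfl⟩ := List.append_of_mem hm
    have hrot : S ++ m :: T ~r m :: T ++ S := List.isRotated_append
    have hlt : ∀ q ∈ T ++ S, f m < f q := by
      intro q hq
      have hqL : q ∈ S ++ m :: T := by simp at hq ⊢; tauto
      refine lt_of_le_of_ne (hmin q (List.mem_toFinset.2 hqL)) fun h => ?_
      have := hf hm hqL h
      subst this
      have := (hrot.nodup_iff.1 hL.sortedLT.nodup)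
      rw [List.cons_append, List.nodup_cons] at this
      exact this.1 hq
    have hpw : ((m :: T ++ S).map f).Pairwise (· < ·) := by
      rw [List.pairwise_map, List.cons_append, List.pairwise_cons]
      refine ⟨hlt, ?_⟩
      have key : (T ++ S).Pairwise (fun p q => CyclicallyOrdered m p q) := by
        simp only [List.pairwise_append, List.pairwise_cons, List.mem_cons,
          forall_eq_or_imp] at hL ⊢
        obtain ⟨h1, ⟨h2, h3⟩, h4⟩ := hL
        refine ⟨h3.imp_of_mem fun hp _ h => Or.inl ⟨h2 _ hp, h⟩,
          h1.imp_of_mem fun _ hq h => Or.inr (Or.inl ⟨h, (h4 _ hq).1⟩),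
          fun p hp q hq => Or.inr (Or.inr ⟨(h4 q hq).1, h2 p hp⟩)⟩
      refine key.imp_of_mem fun {p q} hp hq h => ?_
      have hcyc := hc m hm p (by simp at hp ⊢; tauto) q (by simp at hq ⊢; tauto) h
      have h1 := hlt p hp
      have h2 := hlt q hq
      unfold CyclicallyOrdered at hcyc
      omega
    have heq : (m :: T ++ S).map f = L' :=
      hpw.sortedLT.eq_of_mem_iff hL'.sortedLT fun r => by
        rw [hmem, (hrot.map f).mem_iff]
    exact heq ▸ hrot.map f

theorem points_image (f : ℕ → ℕ) (D : Finset (Sym2 ℕ)) :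
    points (D.image (Sym2.map f)) = (points D).image f := by
  ext r
  simp only [mem_points, Finset.mem_image]
  constructor
  · rintro ⟨_, ⟨c, hc, rfl⟩, hr⟩
    obtain ⟨p, hp, rfl⟩ := Sym2.mem_map.1 hr
    exact ⟨p, ⟨c, hc, hp⟩, rfl⟩
  · rintro ⟨p, ⟨c, hc, hp⟩, rfl⟩
    exact ⟨_, ⟨c, hc, rfl⟩, Sym2.mem_map.2 ⟨p, hp, rfl⟩⟩

theorem Sl2Trace.diagramVal_eq_of_sameDiagram {D D' : Finset (Sym2 ℕ)} (h : SameDiagram D D') :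
    R.diagramVal D = R.diagramVal D' := by
  obtain ⟨f, hf, rfl, hc⟩ := h
  unfold Sl2Trace.diagramVal
  have hrot : (points D).sort.map f ~r (points (D.image (Sym2.map f))).sort := by
    refine CyclicallyOrdered.map_isRotated (Finset.sortedLT_sort _).pairwise
      (Finset.sortedLT_sort _).pairwise (by simpa using hf) ?_ (by simpa using hc)
    simp [points_image]
  rw [← R.val_isRotated hrot, R.val_map (by simpa using hf) (by simp)]

/-! ### The irreducible representations of `sl₂` -/

theorem leviCivita_eq (a b c : Fin 3) : leviCivita a b c =
    (![![![0, 0, 0], ![0, 0, 1], ![0, -1, 0]], ![![0, 0, -1], ![0, 0, 0], ![1, 0, 0]],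
      ![![0, 1, 0], ![-1, 0, 0], ![0, 0, 0]]] : Fin 3 → Fin 3 → Fin 3 → ℤ) a b c := by
  revert a b c; decide

/-- A trace on an algebra that contains an `sl₂`-triple whose Casimir element is a scalar. -/
noncomputable def Sl2Trace.ofTriple {A : Type*} [Ring A] [Algebra ℂ A] (e f h : A) (x : ℂ)
    (tr : A →ₗ[ℂ] ℂ) (hef : e * f - f * e = h) (he : h * e - e * h = (2 : ℂ) • e)
    (hf : h * f - f * h = (-2 : ℂ) • f)
    (hx : (1 / 2 : ℂ) • (e * f + f * e) + (1 / 4 : ℂ) • (h * h) = x • 1)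
    (tr_mul_comm : ∀ a b, tr (a * b) = tr (b * a)) (tr_one : tr 1 = 1) : Sl2Trace A where
  J := ![(1 / 2 : ℂ) • (e + f), (-Complex.I / 2) • (e - f), (1 / 2 : ℂ) • h]
  x := x
  tr := tr
  commutator a b := by
    have h01 : ((1 / 2 : ℂ) • (e + f)) * ((-Complex.I / 2) • (e - f)) -
        ((-Complex.I / 2) • (e - f)) * ((1 / 2 : ℂ) • (e + f)) =
        Complex.I • ((1 / 2 : ℂ) • h) := by
      simp only [smul_mul_smul_comm, mul_add, add_mul, mul_sub, sub_mul]
      linear_combination (norm := module) (Complex.I / 2) • hef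
    have h12 : ((-Complex.I / 2) • (e - f)) * ((1 / 2 : ℂ) • h) -
        ((1 / 2 : ℂ) • h) * ((-Complex.I / 2) • (e - f)) =
        Complex.I • ((1 / 2 : ℂ) • (e + f)) := by
      simp only [smul_mul_smul_comm, mul_sub, sub_mul]
      linear_combination (norm := module) (Complex.I / 4) • he - (Complex.I / 4) • hf
    have h20 : ((1 / 2 : ℂ) • h) * ((1 / 2 : ℂ) • (e + f)) -
        ((1 / 2 : ℂ) • (e + f)) * ((1 / 2 : ℂ) • h) =
        Complex.I • ((-Complex.I / 2) • (e - f)) := by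
      have hI : Complex.I * (-Complex.I / 2) = 1 / 2 := by
        linear_combination (-1 / 2 : ℂ) * Complex.I_mul_I
      rw [smul_smul, hI]
      simp only [smul_mul_smul_comm, mul_add, add_mul]
      linear_combination (norm := module) (1 / 4 : ℂ) • he + (1 / 4 : ℂ) • hf
    have h10 := congrArg Neg.neg h01
    have h21 := congrArg Neg.neg h12
    have h02 := congrArg Neg.neg h20
    rw [neg_sub] at h10 h21 h02
    fin_cases a <;> fin_cases b <;>
      simp only [Fin.sum_univ_three, structureConst, leviCivita_eq, Fin.zero_eta, Fin.mk_one,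
        Fin.reduceFinMk, Matrix.cons_val, Int.cast_zero, Int.cast_one, Int.cast_neg, mul_zero,
        mul_one, mul_neg, zero_smul, neg_smul, add_zero, zero_add, sub_self] <;> assumption
  casimir := by
    have hI : -Complex.I / 2 * (-Complex.I / 2) = -(1 / 4) := by
      linear_combination (1 / 4 : ℂ) * Complex.I_mul_I
    simp only [Fin.sum_univ_three, Matrix.cons_val, smul_mul_smul_comm, mul_add, add_mul, mul_sub,
      sub_mul, hI]
    linear_combination (norm := module) hx
  tr_mul_comm := tr_mul_comm
  tr_one := tr_one

/-- The operators on functions on `Fin N` that form an `sl₂`-triple. -/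
def raising (N : ℕ) : Module.End ℂ (Fin N → ℂ) where
  toFun g n := if h : n.1 + 1 < N then g ⟨n.1 + 1, h⟩ else 0
  map_add' g g' := by funext n; by_cases h : n.1 + 1 < N <;> simp [h]
  map_smul' r g := by funext n; by_cases h : n.1 + 1 < N <;> simp [h]

/-- The lowering operator. -/
def lowering (N : ℕ) : Module.End ℂ (Fin N → ℂ) where
  -- At `n = 0` the truncated index `n - 1` is harmless because the coefficient vanishes.
  toFun g n := n.1 * (N - n.1) * g ⟨n.1 - 1, by omega⟩
  map_add' g g' := by funext n; simp [mul_add]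
  map_smul' r g := by funext n; simp; ring

/-- The weight operator. -/
def weightOp (N : ℕ) : Module.End ℂ (Fin N → ℂ) where
  toFun g n := (N - 1 - 2 * n.1) * g n
  map_add' g g' := by funext n; simp [mul_add]
  map_smul' r g := by funext n; simp; ring

theorem raising_apply (N : ℕ) (g : Fin N → ℂ) (n : Fin N) :
    raising N g n = if h : n.1 + 1 < N then g ⟨n.1 + 1, h⟩ else 0 := rfl

theorem lowering_apply (N : ℕ) (g : Fin N → ℂ) (n : Fin N) :
    lowering N g n = n.1 * (N - n.1) * g ⟨n.1 - 1, by omega⟩ := rfl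

theorem weightOp_apply (N : ℕ) (g : Fin N → ℂ) (n : Fin N) :
    weightOp N g n = (N - 1 - 2 * n.1) * g n := rfl

theorem raising_lowering_apply (N : ℕ) (g : Fin N → ℂ) (n : Fin N) :
    raising N (lowering N g) n = (n.1 + 1) * (N - n.1 - 1) * g n := by
  rw [raising_apply]
  split_ifs with h
  · simp only [lowering_apply, Nat.add_sub_cancel]
    push_cast
    ring
  -- At the last index the raising operator gives zero, and so does the coefficient `N - n - 1`.
  · have : (N : ℂ) = n.1 + 1 := by
      have : N = n.1 + 1 := by omega
      exact_mod_cast this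
    rw [this]; ring

theorem lowering_raising_apply (N : ℕ) (g : Fin N → ℂ) (n : Fin N) :
    lowering N (raising N g) n = n.1 * (N - n.1) * g n := by
  rw [lowering_apply, raising_apply]
  rcases Nat.eq_zero_or_pos n.1 with h | h
  · simp [h]
  · have h1 : n.1 - 1 + 1 = n.1 := by omega
    simp only [h1, n.2, dif_pos]

/-- The normalized trace on the representation of dimension `2l + 1`. -/
noncomputable def spin (l : ℕ) : Sl2Trace (Module.End ℂ (Fin (2 * l + 1) → ℂ)) :=
  -- The Casimir eigenvalue in dimension `N` is `(N² - 1) / 4`, here with `N = 2l + 1`.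
  Sl2Trace.ofTriple (raising _) (lowering _) (weightOp _) (l * (l + 1))
    ((1 / (2 * l + 1 : ℂ)) • LinearMap.trace ℂ _)
    (by
      refine LinearMap.ext fun g => funext fun n => ?_
      simp only [LinearMap.sub_apply, Module.End.mul_apply, Pi.sub_apply, raising_lowering_apply,
        lowering_raising_apply, weightOp_apply]
      ring)
    (by
      refine LinearMap.ext fun g => funext fun n => ?_
      simp only [LinearMap.sub_apply, Module.End.mul_apply, Pi.sub_apply, weightOp_apply,
        raising_apply, LinearMap.smul_apply, Pi.smul_apply, smul_eq_mul]
      split_ifs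
      · push_cast; ring
      · ring)
    (by
      refine LinearMap.ext fun g => funext fun n => ?_
      simp only [LinearMap.sub_apply, Module.End.mul_apply, Pi.sub_apply, weightOp_apply,
        lowering_apply, LinearMap.smul_apply, Pi.smul_apply, smul_eq_mul]
      rcases Nat.eq_zero_or_pos n.1 with h | h
      · simp [h]
      · rw [Nat.cast_sub h]; push_cast; ring)
    (by
      refine LinearMap.ext fun g => funext fun n => ?_
      simp only [LinearMap.add_apply, Module.End.mul_apply, Pi.add_apply, raising_lowering_apply,
        lowering_raising_apply, weightOp_apply, LinearMap.smul_apply, Pi.smul_apply, smul_eq_mul,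
        Module.End.one_apply]
      push_cast; ring)
    (fun a b => by simp [LinearMap.trace_mul_comm ℂ a b])
    (by
      have : (2 * l + 1 : ℂ) ≠ 0 := by exact_mod_cast (Nat.succ_ne_zero (2 * l))
      simp [this])

theorem spin_x (l : ℕ) : (spin l).x = l * (l + 1) := rfl

/-- The numbers `l(l+1)` are pairwise distinct, so the difference has infinitely many roots. This
reduces every identity between weights to one between traces. -/
theorem eq_of_forall_aeval_spin {p q : ℤ[X]}
    (h : ∀ l, aeval (spin l).x p = aeval (spin l).x q) : p = q := by
  rw [← sub_eq_zero]
  have hinj : Function.Injective (algebraMap ℤ ℂ) := by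
    simpa using (Int.cast_injective (α := ℂ))
  rw [← Polynomial.map_eq_zero_iff hinj]
  refine Polynomial.eq_zero_of_infinite_isRoot _ (Set.Infinite.mono
    (s := Set.range fun l : ℕ => (l * (l + 1) : ℂ)) ?_ (Set.infinite_range_of_injective ?_))
  · rintro _ ⟨l, rfl⟩
    have := h l
    rw [spin_x] at this
    change eval _ _ = 0
    rw [eval_map_algebraMap, map_sub, this, sub_self]
  · intro l l' hl
    have h1 : l * (l + 1) = l' * (l' + 1) := by
      simp only at hl
      exact_mod_cast hl
    rcases lt_trichotomy l l' with h2 | h2 | h2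
    · nlinarith
    · exact h2
    · nlinarith

theorem isUniversalSl2Weight_weight : IsUniversalSl2Weight weight where
  one_chord D hD hcard := by
    obtain ⟨a, rfl⟩ := Finset.card_eq_one.1 hcard
    refine eq_of_forall_aeval_spin fun l => ?_
    have h1 : crossing {a} a = ∅ := by
      refine Finset.eq_empty_of_forall_notMem fun c hc => ?_
      simp only [crossing, Finset.mem_filter, Finset.mem_singleton] at hc
      obtain ⟨-, rfl, h1, -⟩ := hc
      simp only [Sym2.inf_mk, Sym2.sup_mk] at h1
      grind
    -- Along the only chord the recursion leads to `x` times the empty diagram, whose value is the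
    -- trace of `1`.
    rw [(spin l).aeval_weight hD, (spin l).diagramVal_recursion hD (Finset.mem_singleton_self a),
      h1]
    simp [Sl2Trace.diagramVal, Sl2Trace.val, points, diagramDelta, Sl2Trace.word,
      (spin l).tr_one]
  recursion D hD _ a ha := eq_of_forall_aeval_spin fun l => by
    rw [(spin l).aeval_weight hD,
      (spin l).aeval_recursionRHS hD ha fun E hE _ => (spin l).aeval_weight hE]
  invariant D D' hD hD' h := eq_of_forall_aeval_spin fun l => by
    rw [(spin l).aeval_weight hD, (spin l).aeval_weight hD',
      (spin l).diagramVal_eq_of_sameDiagram h]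

/-! ### Identities for sums over colors -/

theorem sum_contract (f : Fin 3 → Fin 3 → Fin 3 → Fin 3 → ℂ) :
    ∑ t, ∑ a, ∑ b, ∑ c, ∑ d, structureConst t a b * structureConst t c d * f a b c d =
      ∑ a, ∑ b, (f a b b a - f a b a b) := by
  rw [Finset.sum_comm]
  refine Finset.sum_congr rfl fun a _ => ?_
  rw [Finset.sum_comm]
  refine Finset.sum_congr rfl fun b _ => ?_
  rw [Finset.sum_comm]
  have h1 : ∀ c, ∑ t, ∑ d, structureConst t a b * structureConst t c d * f a b c d =
      ∑ d, ((if a = d then 1 else 0) * (if b = c then 1 else 0) -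
        (if a = c then 1 else 0) * (if b = d then 1 else 0)) * f a b c d := by
    intro c
    rw [Finset.sum_comm]
    refine Finset.sum_congr rfl fun d _ => ?_
    rw [← Finset.sum_mul, sum_structureConst_mul]
  simp only [h1, sub_mul, Finset.sum_sub_distrib]
  simp

theorem sum_contract_inner (t : Fin 3) (f : Fin 3 → Fin 3 → Fin 3 → ℂ) :
    ∑ c, ∑ d, ∑ y, ∑ l, structureConst t c d * structureConst c y l * f d y l =
      ∑ d, (f d t d - f d d t) := by
  rw [Finset.sum_comm]
  refine Finset.sum_congr rfl fun d _ => ?_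
  rw [Finset.sum_comm]
  have h1 : ∀ y, ∑ c, ∑ l, structureConst t c d * structureConst c y l * f d y l =
      ∑ l, ((if t = y then 1 else 0) * (if d = l then 1 else 0) -
        (if t = l then 1 else 0) * (if d = y then 1 else 0)) * f d y l := by
    intro y
    rw [Finset.sum_comm]
    refine Finset.sum_congr rfl fun l _ => ?_
    have h2 := sum_structureConst_mul t d y l
    rw [← Finset.sum_mul, ← neg_sub, ← h2, ← Finset.sum_neg_distrib]
    congr 1
    refine Finset.sum_congr rfl fun c _ => ?_
    rw [structureConst_swap_left t c d]
    ring
  simp only [h1, sub_mul, Finset.sum_sub_distrib]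
  simp

/-- `J y` is moved across in one argument at a time; each move costs one commutator. -/
theorem Sl2Trace.bilin_sub (β : A →ₗ[ℂ] A →ₗ[ℂ] ℂ) (c d y : Fin 3) :
    β (R.J c * R.J y) (R.J d * R.J y) - β (R.J y * R.J c) (R.J y * R.J d) =
      ∑ l, structureConst c y l * β (R.J l) (R.J d * R.J y) +
      ∑ l, structureConst d y l * β (R.J y * R.J c) (R.J l) := by
  have h1 : β (R.J c * R.J y) (R.J d * R.J y) - β (R.J y * R.J c) (R.J d * R.J y) =
      ∑ l, structureConst c y l * β (R.J l) (R.J d * R.J y) := by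
    rw [← LinearMap.sub_apply, ← map_sub, R.commutator]
    simp
  have h2 : β (R.J y * R.J c) (R.J d * R.J y) - β (R.J y * R.J c) (R.J y * R.J d) =
      ∑ l, structureConst d y l * β (R.J y * R.J c) (R.J l) := by
    rw [← map_sub, R.commutator]
    simp
  rw [← h1, ← h2]
  ring

/-- Each commutator of `bilin_sub` carries a structure constant that contracts with the given one.
Of the resulting deltas, one kind produces `∑ J d * J d`, hence the terms with `x`. -/
theorem Sl2Trace.sum_bilin (β : A →ₗ[ℂ] A →ₗ[ℂ] ℂ) (t : Fin 3) :
    ∑ c, ∑ d, ∑ y, structureConst t c d *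
      (β (R.J c * R.J y) (R.J d * R.J y) - β (R.J y * R.J c) (R.J y * R.J d)) =
    ∑ a, β (R.J a) (R.J a * R.J t) - R.x * β (R.J t) 1 + R.x * β 1 (R.J t) -
      ∑ a, β (R.J t * R.J a) (R.J a) := by
  have h1 := sum_contract_inner t fun d y l => β (R.J l) (R.J d * R.J y)
  have h2 := sum_contract_inner t fun d y l => β (R.J y * R.J d) (R.J l)
  rw [Finset.sum_comm] at h2
  have h3 : ∑ d, β (R.J t) (R.J d * R.J d) = R.x * β (R.J t) 1 := by
    rw [← map_sum, R.casimir]; simp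
  have h4 : ∑ d, β (R.J d * R.J d) (R.J t) = R.x * β 1 (R.J t) := by
    rw [← LinearMap.sum_apply, ← map_sum, R.casimir]; simp
  simp only [R.bilin_sub, mul_add, Finset.mul_sum, Finset.sum_add_distrib, ← mul_assoc]
  rw [h1]
  have h5 : ∀ c d y l, structureConst t c d * structureConst d y l * β (R.J y * R.J c) (R.J l) =
      -(structureConst t d c * structureConst d y l * β (R.J y * R.J c) (R.J l)) := by
    intro c d y l
    rw [structureConst_swap t c d]; ring
  simp only [h5, Finset.sum_neg_distrib]
  rw [h2]
  simp only [Finset.sum_sub_distrib, h3, h4]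
  ring

/-- The sum over the colors of `u`, `v` of the two ways to connect a pair of slots. -/
theorem sum_antisymm (h : Fin 3 → Fin 3 → Fin 3 → Fin 3 → ℂ) :
    ∑ u, ∑ v, (h u v u v - h u v v u) =
      -∑ t, ∑ u, ∑ v, ∑ c, ∑ d, structureConst t u v * structureConst t c d * h u v c d := by
  rw [sum_contract]
  simp

/-- A structure constant contracted with two slots can be absorbed as a commutator with `J t` in
either slot; here the left one, in `sum_slot_right` the right one. -/
theorem Sl2Trace.sum_slot_left (t : Fin 3) (g : A →ₗ[ℂ] A →ₗ[ℂ] ℂ) :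
    ∑ u, ∑ v, structureConst t u v * g (R.J u) (R.J v) =
      ∑ v, g (R.J v * R.J t - R.J t * R.J v) (R.J v) := by
  rw [Finset.sum_comm]
  refine Finset.sum_congr rfl fun v _ => ?_
  rw [R.commutator]
  simp only [map_sum, map_smul, LinearMap.sum_apply, LinearMap.smul_apply, smul_eq_mul]
  refine Finset.sum_congr rfl fun u _ => ?_
  rw [structureConst_swap, structureConst_swap_left t v u, neg_neg]

theorem Sl2Trace.sum_slot_right (t : Fin 3) (g : A →ₗ[ℂ] A →ₗ[ℂ] ℂ) :
    ∑ u, ∑ v, structureConst t u v * g (R.J u) (R.J v) =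
      ∑ u, g (R.J u) (R.J t * R.J u - R.J u * R.J t) := by
  refine Finset.sum_congr rfl fun u _ => ?_
  rw [R.commutator]
  simp

/-- The bilinear form obtained by cutting a circle at two places. -/
noncomputable def Sl2Trace.cut (W Z : A) : A →ₗ[ℂ] A →ₗ[ℂ] ℂ :=
  LinearMap.mk₂ ℂ (fun P Q => R.tr (P * W * Q * Z)) (by simp [add_mul]) (by simp)
    (by simp [add_mul, mul_add]) (by simp)

theorem Sl2Trace.cut_apply (W Z P Q : A) : R.cut W Z P Q = R.tr (P * W * Q * Z) := rfl

/-- The integrand of `valB_difference`. The four terms on the left have the form `h u v u v - h u v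
v u`, so `sum_antisymm` rewrites them with two structure constants. The one in `c, d` is removed by
`sum_bilin`, the one in `u, v` becomes a commutator by `sum_slot_left` or `sum_slot_right`. -/
theorem Sl2Trace.exchange_identity (W Z : A) :
    ∑ u, ∑ v, ∑ y, (R.tr (R.J u * W * R.J u * R.J y * Z * R.J v * W * R.J v * R.J y * Z) -
      R.tr (R.J u * W * R.J y * R.J u * Z * R.J v * W * R.J y * R.J v * Z) +
      R.tr (R.J u * W * R.J y * R.J v * Z * R.J v * W * R.J y * R.J u * Z) -
      R.tr (R.J u * W * R.J v * R.J y * Z * R.J v * W * R.J u * R.J y * Z)) =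
    ∑ t, ∑ c, ∑ a, (R.tr (R.J c * W * R.J a * Z * (R.J c * R.J t - R.J t * R.J c) * W *
        R.J a * R.J t * Z) +
      R.tr ((R.J c * R.J t - R.J t * R.J c) * W * R.J t * R.J a * Z * R.J c * W * R.J a * Z)) +
    R.x * ∑ t, ∑ c, (R.tr ((R.J c * R.J t - R.J t * R.J c) * W * R.J t * Z * R.J c * W * Z) +
      R.tr (R.J c * W * Z * (R.J c * R.J t - R.J t * R.J c) * W * R.J t * Z)) := by
  have h1 : ∀ p q P Q : A, R.cut (Z * q * W) (Z * p * W) P Q =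
      R.tr (p * W * P * Z * q * W * Q * Z) := by
    intro p q P Q
    rw [R.cut_apply, R.tr_mul_comm, R.tr_mul_comm _ Z]
    congr 1
    noncomm_ring
  have h2 : ∀ p q P Q : A, R.cut (W * P * Z) (W * Q * Z) p q =
      R.tr (p * W * P * Z * q * W * Q * Z) := by
    intro p q P Q
    rw [R.cut_apply]
    congr 1
    noncomm_ring
  have h3 : ∀ t u v, ∑ c, ∑ d, structureConst t u v * structureConst t c d *
      ∑ y, (R.cut (Z * R.J v * W) (Z * R.J u * W) (R.J c * R.J y) (R.J d * R.J y) -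
        R.cut (Z * R.J v * W) (Z * R.J u * W) (R.J y * R.J c) (R.J y * R.J d)) =
      structureConst t u v * (∑ a, R.cut (W * R.J a * Z) (W * (R.J a * R.J t) * Z) (R.J u) (R.J v) -
        R.x * R.cut (W * R.J t * Z) (W * 1 * Z) (R.J u) (R.J v) +
        R.x * R.cut (W * 1 * Z) (W * R.J t * Z) (R.J u) (R.J v) -
        ∑ a, R.cut (W * (R.J t * R.J a) * Z) (W * R.J a * Z) (R.J u) (R.J v)) := by
    intro t u v
    simp only [h2]
    simp only [← h1]
    rw [← R.sum_bilin (R.cut (Z * R.J v * W) (Z * R.J u * W)) t]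
    simp only [Finset.mul_sum, mul_assoc]
  have h4 : ∀ t, ∑ u, ∑ v, structureConst t u v *
      (∑ a, R.cut (W * R.J a * Z) (W * (R.J a * R.J t) * Z) (R.J u) (R.J v) -
        R.x * R.cut (W * R.J t * Z) (W * 1 * Z) (R.J u) (R.J v) +
        R.x * R.cut (W * 1 * Z) (W * R.J t * Z) (R.J u) (R.J v) -
        ∑ a, R.cut (W * (R.J t * R.J a) * Z) (W * R.J a * Z) (R.J u) (R.J v)) =
      ∑ a, ∑ u, ∑ v, structureConst t u v *
          R.cut (W * R.J a * Z) (W * (R.J a * R.J t) * Z) (R.J u) (R.J v) -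
        R.x * ∑ u, ∑ v, structureConst t u v *
          R.cut (W * R.J t * Z) (W * 1 * Z) (R.J u) (R.J v) +
        R.x * ∑ u, ∑ v, structureConst t u v *
          R.cut (W * 1 * Z) (W * R.J t * Z) (R.J u) (R.J v) -
        ∑ a, ∑ u, ∑ v, structureConst t u v *
          R.cut (W * (R.J t * R.J a) * Z) (W * R.J a * Z) (R.J u) (R.J v) := by
    intro t
    have e : ∀ F : Fin 3 → Fin 3 → Fin 3 → ℂ, ∑ a, ∑ u, ∑ v, F a u v =
        ∑ u, ∑ v, ∑ a, F a u v := by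
      intro F
      rw [Finset.sum_comm]
      exact Finset.sum_congr rfl fun u _ => Finset.sum_comm
    rw [e (fun a u v => structureConst t u v *
        R.cut (W * R.J a * Z) (W * (R.J a * R.J t) * Z) (R.J u) (R.J v)),
      e (fun a u v => structureConst t u v *
        R.cut (W * (R.J t * R.J a) * Z) (W * R.J a * Z) (R.J u) (R.J v))]
    simp only [Finset.mul_sum, ← Finset.sum_sub_distrib, ← Finset.sum_add_distrib]
    refine Finset.sum_congr rfl fun u _ => Finset.sum_congr rfl fun v _ => ?_
    simp only [← Finset.mul_sum]
    ring
  have h5 := sum_antisymm fun u v c d =>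
    ∑ y, (R.cut (Z * R.J v * W) (Z * R.J u * W) (R.J c * R.J y) (R.J d * R.J y) -
        R.cut (Z * R.J v * W) (Z * R.J u * W) (R.J y * R.J c) (R.J y * R.J d))
  simp only [h3, h4] at h5
  refine Eq.trans ?_ (h5.trans ?_)
  · refine Finset.sum_congr rfl fun u _ => Finset.sum_congr rfl fun v _ => ?_
    rw [← Finset.sum_sub_distrib]
    refine Finset.sum_congr rfl fun y _ => ?_
    simp only [h1, ← mul_assoc]
    ring
  · simp only [R.sum_slot_right _ (R.cut (W * R.J _ * Z) (W * (R.J _ * R.J _) * Z)),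
      R.sum_slot_right _ (R.cut (W * 1 * Z) (W * R.J _ * Z)),
      R.sum_slot_left _ (R.cut (W * (R.J _ * R.J _) * Z) (W * R.J _ * Z)),
      R.sum_slot_left _ (R.cut (W * R.J _ * Z) (W * 1 * Z))]
    rw [Finset.mul_sum, ← Finset.sum_add_distrib, ← Finset.sum_neg_distrib]
    refine Finset.sum_congr rfl fun t _ => ?_
    rw [Finset.sum_comm, Finset.sum_comm (f := fun a v => R.cut (W * (R.J t * R.J a) * Z) _ _ _)]
    simp only [Finset.sum_add_distrib]
    have n1 : ∀ u a, R.cut (W * R.J a * Z) (W * (R.J a * R.J t) * Z) (R.J u)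
        (R.J t * R.J u - R.J u * R.J t) = -R.tr (R.J u * W * R.J a * Z *
          (R.J u * R.J t - R.J t * R.J u) * W * R.J a * R.J t * Z) := by
      intro u a
      rw [← map_neg, h2]
      congr 1
      noncomm_ring
    have n2 : ∀ u, R.cut (W * 1 * Z) (W * R.J t * Z) (R.J u)
        (R.J t * R.J u - R.J u * R.J t) = -R.tr (R.J u * W * Z *
          (R.J u * R.J t - R.J t * R.J u) * W * R.J t * Z) := by
      intro u
      rw [← map_neg, h2]
      congr 1
      noncomm_ring
    simp only [n1, n2, h2, Finset.sum_neg_distrib]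
    simp only [← mul_assoc, mul_one]
    ring

/-- The common index `s` is contracted: one delta product closes up a chord between the two slots,
the other puts `J y` and `J p` in exchanged slots. -/
theorem Sl2Trace.sum_commutator_commutator (g : A →ₗ[ℂ] A →ₗ[ℂ] ℂ) (p y : Fin 3) :
    ∑ s, g (R.J p * R.J s - R.J s * R.J p) (R.J s * R.J y - R.J y * R.J s) =
      (if p = y then ∑ a, g (R.J a) (R.J a) else 0) - g (R.J y) (R.J p) := by
  have h : ∀ s, g (R.J p * R.J s - R.J s * R.J p) (R.J s * R.J y - R.J y * R.J s) =
      ∑ l, ∑ m, -(structureConst s p l * structureConst s y m) * g (R.J l) (R.J m) := by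
    intro s
    rw [R.commutator, R.commutator]
    simp only [map_sum, map_smul, LinearMap.sum_apply, LinearMap.smul_apply, smul_eq_mul,
      Finset.mul_sum]
    rw [Finset.sum_comm]
    refine Finset.sum_congr rfl fun l _ => Finset.sum_congr rfl fun m _ => ?_
    rw [structureConst_swap_left p s l]
    ring
  simp only [h]
  rw [Finset.sum_comm]
  have h2 : ∀ l, ∑ s, ∑ m, -(structureConst s p l * structureConst s y m) * g (R.J l) (R.J m) =
      ∑ m, ((if p = y then 1 else 0) * (if l = m then 1 else 0) -
        (if p = m then 1 else 0) * (if l = y then 1 else 0)) * g (R.J l) (R.J m) := by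
    intro l
    rw [Finset.sum_comm]
    refine Finset.sum_congr rfl fun m _ => ?_
    rw [← Finset.sum_mul, Finset.sum_neg_distrib, sum_structureConst_mul]
    ring
  simp only [h2, sub_mul, Finset.sum_sub_distrib]
  simp


/-! ### Sums over the colors of parallel chords -/

/-- Sum over all products of `a` basis elements. -/
def Sl2Trace.wordSum : ℕ → (A → ℂ) → ℂ
  | 0, G => G 1
  | a + 1, G => Sl2Trace.wordSum a fun w => ∑ c, G (R.J c * w)

theorem Sl2Trace.wordSum_zero (G : A → ℂ) : R.wordSum 0 G = G 1 := rfl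

theorem Sl2Trace.wordSum_succ (a : ℕ) (G : A → ℂ) :
    R.wordSum (a + 1) G = R.wordSum a fun w => ∑ c, G (R.J c * w) := rfl

/-- As the sum runs over all words, a letter may be split off at either end. The relations below
need this freedom to choose which chord of a block is singled out. -/
theorem Sl2Trace.wordSum_succ' (a : ℕ) (G : A → ℂ) :
    R.wordSum (a + 1) G = R.wordSum a fun w => ∑ c, G (w * R.J c) := by
  induction a generalizing G with
  | zero => simp [Sl2Trace.wordSum]
  | succ a ih =>
    rw [wordSum_succ, ih, wordSum_succ]
    congr 1
    funext w
    rw [Finset.sum_comm]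
    simp only [mul_assoc]

theorem Sl2Trace.wordSum_add (a : ℕ) (F G : A → ℂ) :
    R.wordSum a (fun w => F w + G w) = R.wordSum a F + R.wordSum a G := by
  induction a generalizing F G with
  | zero => rfl
  | succ a ih => simp only [wordSum_succ, Finset.sum_add_distrib, ih]

theorem Sl2Trace.wordSum_mul_left (a : ℕ) (r : ℂ) (F : A → ℂ) :
    R.wordSum a (fun w => r * F w) = r * R.wordSum a F := by
  induction a generalizing F with
  | zero => rfl
  | succ a ih => simp only [wordSum_succ, ← Finset.mul_sum, ih]

theorem Sl2Trace.wordSum_sub (a : ℕ) (F G : A → ℂ) :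
    R.wordSum a (fun w => F w - G w) = R.wordSum a F - R.wordSum a G := by
  have := R.wordSum_add a F fun w => (-1) * G w
  rw [R.wordSum_mul_left] at this
  simpa [sub_eq_add_neg] using this

theorem Sl2Trace.wordSum_sum (a : ℕ) (F : Fin 3 → A → ℂ) :
    R.wordSum a (fun w => ∑ i, F i w) = ∑ i, R.wordSum a (F i) := by
  simp only [Fin.sum_univ_three, R.wordSum_add]

theorem Sl2Trace.wordSum_comm (a b : ℕ) (F : A → A → ℂ) :
    R.wordSum a (fun w => R.wordSum b fun z => F w z) =
      R.wordSum b (fun z => R.wordSum a fun w => F w z) := by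
  induction a generalizing F with
  | zero => rfl
  | succ a ih =>
    simp only [wordSum_succ]
    rw [← ih]
    simp only [wordSum_sum]

/-- Sum over two independent products of basis elements. -/
def Sl2Trace.blockSum (a b : ℕ) (G : A → A → ℂ) : ℂ :=
  R.wordSum a fun w => R.wordSum b fun z => G w z

theorem Sl2Trace.blockSum_swap (a b : ℕ) (G : A → A → ℂ) :
    R.blockSum a b G = R.blockSum b a fun z w => G w z := R.wordSum_comm a b G

theorem Sl2Trace.blockSum_right (a b : ℕ) (G : A → A → ℂ) :
    R.blockSum a (b + 1) G = R.blockSum a b fun w z => ∑ c, G w (R.J c * z) := rfl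

theorem Sl2Trace.blockSum_right' (a b : ℕ) (G : A → A → ℂ) :
    R.blockSum a (b + 1) G = R.blockSum a b fun w z => ∑ c, G w (z * R.J c) := by
  simp only [blockSum, R.wordSum_succ']

theorem Sl2Trace.blockSum_left (a b : ℕ) (G : A → A → ℂ) :
    R.blockSum (a + 1) b G = R.blockSum a b fun w z => ∑ c, G (R.J c * w) z := by
  rw [blockSum_swap, blockSum_right, blockSum_swap]

theorem Sl2Trace.blockSum_left' (a b : ℕ) (G : A → A → ℂ) :
    R.blockSum (a + 1) b G = R.blockSum a b fun w z => ∑ c, G (w * R.J c) z := by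
  rw [blockSum_swap, blockSum_right', blockSum_swap]

theorem Sl2Trace.blockSum_add (a b : ℕ) (F G : A → A → ℂ) :
    R.blockSum a b (fun w z => F w z + G w z) = R.blockSum a b F + R.blockSum a b G := by
  simp only [blockSum, R.wordSum_add]

theorem Sl2Trace.blockSum_sub (a b : ℕ) (F G : A → A → ℂ) :
    R.blockSum a b (fun w z => F w z - G w z) = R.blockSum a b F - R.blockSum a b G := by
  simp only [blockSum, R.wordSum_sub]

theorem Sl2Trace.blockSum_mul_left (a b : ℕ) (r : ℂ) (F : A → A → ℂ) :
    R.blockSum a b (fun w z => r * F w z) = r * R.blockSum a b F := by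
  simp only [blockSum, R.wordSum_mul_left]

/-! ### The values of the three families -/

/-- The value of `n` mutually crossing chords. -/
noncomputable def Sl2Trace.valD (n : ℕ) : ℂ := R.wordSum n fun w => R.tr (w * w)

/-- The value of `a + b` mutually crossing chords and a chord that crosses `a` of them. -/
noncomputable def Sl2Trace.valA (a b : ℕ) : ℂ :=
  R.blockSum a b fun w z => ∑ s, R.tr (R.J s * w * R.J s * z * w * z)

/-- The value of `a + b` mutually crossing chords and two parallel chords that cross the same
`a` of them. -/
noncomputable def Sl2Trace.valB (a b : ℕ) : ℂ :=
  R.blockSum a b fun w z => ∑ u, ∑ v, R.tr (R.J u * w * R.J u * z * R.J v * w * R.J v * z)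

/-! ### Boundary values of the three families and the linear relations between them. -/

theorem Sl2Trace.tr_casimir_mul (P : A) : ∑ s, R.tr (R.J s * R.J s * P) = R.x * R.tr P := by
  rw [← map_sum, ← Finset.sum_mul, R.casimir]
  simp

/-- Moving `J s` past `J c` leaves the Casimir element and a sum of `J l * J s` against a structure
constant antisymmetric in `s, l`. Antisymmetry makes this sum half of a sum of commutators, and a
contraction evaluates it to `-J c`. So a chord crossing exactly one other chord contributes `x - 1`.
-/
theorem Sl2Trace.sum_mul_J_mul (c : Fin 3) :
    ∑ s, R.J s * R.J c * R.J s = (R.x - 1) • R.J c := by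
  have h1 : ∀ s, R.J s * R.J c * R.J s = R.J c * (R.J s * R.J s) +
      ∑ l, structureConst s c l • (R.J l * R.J s) := by
    intro s
    have := congrArg (fun y => y * R.J s) (R.commutator s c)
    simp only [Finset.sum_mul, smul_mul_assoc] at this
    rw [← this]
    noncomm_ring
  have h2 : ∑ s, ∑ l, structureConst s c l • (R.J l * R.J s) = -R.J c := by
    have h3 : ∑ s, ∑ l, structureConst s c l • (R.J s * R.J l) =
        -∑ s, ∑ l, structureConst s c l • (R.J l * R.J s) := by
      rw [Finset.sum_comm, ← Finset.sum_neg_distrib]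
      refine Finset.sum_congr rfl fun s _ => ?_
      rw [← Finset.sum_neg_distrib]
      refine Finset.sum_congr rfl fun l _ => ?_
      rw [← neg_smul]
      congr 1
      rw [structureConst_swap_left, structureConst_swap, structureConst_swap_left s c l, neg_neg]
    have h4 : ∑ s, ∑ l, structureConst s c l • (R.J l * R.J s - R.J s * R.J l) =
        -(2 : ℂ) • R.J c := by
      have h5 : ∀ m, ∑ s, ∑ l, structureConst s c l * structureConst l s m =
          if c = m then (-2 : ℂ) else 0 := by
        intro m
        have h6 : ∀ s l, structureConst s c l * structureConst l s m =
            -(structureConst s c l * structureConst s l m) := by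
          intro s l
          rw [structureConst_swap_left l s m]; ring
        simp only [h6, Finset.sum_neg_distrib]
        rw [Finset.sum_comm]
        simp only [sum_structureConst_mul]
        fin_cases c <;> fin_cases m <;> norm_num [Fin.sum_univ_three]
      calc _ = ∑ m, (∑ s, ∑ l, structureConst s c l * structureConst l s m) • R.J m := by
            simp only [R.commutator, Finset.smul_sum, smul_smul, Finset.sum_smul]
            symm
            rw [Finset.sum_comm]
            exact Finset.sum_congr rfl fun t _ => Finset.sum_comm
        _ = _ := by simp [h5]
    simp only [smul_sub, Finset.sum_sub_distrib, h3] at h4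
    linear_combination (norm := module) (1 / 2 : ℂ) • h4
  simp only [h1, Finset.sum_add_distrib, h2, ← Finset.mul_sum, R.casimir]
  simp [sub_smul]
  abel

theorem Sl2Trace.valA_zero_left (n : ℕ) : R.valA 0 n = R.x * R.valD n := by
  simp only [valA, valD, blockSum, wordSum_zero, mul_one, ← R.wordSum_mul_left]
  congr 1
  funext z
  simp only [mul_assoc (R.J _ * R.J _), R.tr_casimir_mul]

theorem Sl2Trace.valA_zero_right (n : ℕ) : R.valA n 0 = R.valD (n + 1) := by
  simp only [valA, valD, blockSum, wordSum_zero, mul_one, one_mul, wordSum_succ, mul_assoc]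

theorem Sl2Trace.valB_zero_left (n : ℕ) : R.valB 0 n = R.x ^ 2 * R.valD n := by
  simp only [valB, valD, blockSum, wordSum_zero, mul_one, ← R.wordSum_mul_left]
  congr 1
  funext z
  rw [Finset.sum_comm]
  have : ∀ v, ∑ u, R.tr (R.J u * R.J u * z * R.J v * R.J v * z) =
      R.x * R.tr (R.J v * R.J v * (z * z)) := by
    intro v
    have h := R.tr_casimir_mul (z * R.J v * R.J v * z)
    simp only [← mul_assoc] at h
    rw [h, R.tr_mul_comm]
    simp only [mul_assoc]
    rw [← mul_assoc, R.tr_mul_comm]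
    simp only [mul_assoc]
  simp only [this, ← Finset.mul_sum, R.tr_casimir_mul]
  ring

theorem Sl2Trace.valA_one_left (n : ℕ) : R.valA 1 n = (R.x - 1) * R.valD (n + 1) := by
  rw [valA, blockSum_left, valD, wordSum_succ, ← R.wordSum_mul_left]
  refine congrArg (R.wordSum n) ?_
  funext z
  rw [Finset.mul_sum]
  refine Finset.sum_congr rfl fun c _ => ?_
  have h := congrArg (fun P => R.tr (P * z * R.J c * z)) (R.sum_mul_J_mul c)
  simp only [Finset.sum_mul, map_sum, smul_mul_assoc, map_smul, smul_eq_mul] at h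
  simp only [mul_one, h]
  simp only [mul_assoc]

/-- Expanding `∑ g([J p, J s], [J s, J p])` gives twice the difference of the two diagrams with `n +
2` chords. By `sum_commutator_commutator` with `p = y`, summed over `p`, it is also `(3 - 1) ∑ g(J
a, J a)`, twice the value with `n + 1` chords. -/
theorem Sl2Trace.valB_zero_right (n : ℕ) : R.valB n 0 = R.valD (n + 2) + R.valD (n + 1) := by
  simp only [valB, valD, blockSum, wordSum_zero, mul_one, wordSum_succ]
  rw [← R.wordSum_add]
  refine congrArg (R.wordSum n) ?_
  funext w
  have h1 : ∀ u v, R.tr (R.J u * w * R.J u * R.J v * w * R.J v) =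
      R.cut w w (R.J v * R.J u) (R.J u * R.J v) := by
    intro u v
    rw [R.tr_mul_comm, R.cut_apply]
    simp only [mul_assoc]
  have h2 : ∀ c d, R.tr (R.J c * (R.J d * w) * (R.J c * (R.J d * w))) =
      R.cut w w (R.J c * R.J d) (R.J c * R.J d) := by
    intro c d
    rw [R.cut_apply]
    simp only [mul_assoc]
  have h3 : ∀ c, R.tr (R.J c * w * (R.J c * w)) = R.cut w w (R.J c) (R.J c) := by
    intro c
    rw [R.cut_apply]
    simp only [mul_assoc]
  simp only [h1, h2, h3]
  have h4 : ∀ p s, R.cut w w (R.J p * R.J s - R.J s * R.J p) (R.J s * R.J p - R.J p * R.J s) =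
      R.cut w w (R.J p * R.J s) (R.J s * R.J p) - R.cut w w (R.J p * R.J s) (R.J p * R.J s) -
      R.cut w w (R.J s * R.J p) (R.J s * R.J p) + R.cut w w (R.J s * R.J p) (R.J p * R.J s) := by
    intro p s
    simp only [map_sub, LinearMap.sub_apply]
    ring
  have h5 := Finset.sum_congr rfl fun p (_ : p ∈ (Finset.univ : Finset (Fin 3))) =>
    R.sum_commutator_commutator (R.cut w w) p p
  simp only [h4, Finset.sum_sub_distrib, Finset.sum_add_distrib, if_true, Finset.sum_const,
    Finset.card_univ, Fintype.card_fin, nsmul_eq_mul] at h5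
  rw [Finset.sum_comm (f := fun p s => R.cut w w (R.J p * R.J s) (R.J s * R.J p)),
    Finset.sum_comm (f := fun p s => R.cut w w (R.J s * R.J p) (R.J s * R.J p))] at h5
  rw [Finset.sum_comm (f := fun c d => R.cut w w (R.J d * R.J c) (R.J d * R.J c))]
  push_cast at h5
  linear_combination (1 / 2 : ℂ) * h5

theorem Sl2Trace.valA_right_right (q m : ℕ) :
    R.valA q (m + 2) = R.blockSum q m fun w z => ∑ p, ∑ y, ∑ s,
      R.tr (R.J s * w * R.J s * (R.J y * (z * R.J p)) * w * (R.J y * (z * R.J p))) := by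
  rw [valA, blockSum_right, blockSum_right']

theorem Sl2Trace.valA_left'_right' (q m : ℕ) :
    R.valA (q + 1) (m + 1) = R.blockSum q m fun w z => ∑ p, ∑ y, ∑ s,
      R.tr (R.J s * (w * R.J y) * R.J s * (z * R.J p) * (w * R.J y) * (z * R.J p)) := by
  rw [valA, blockSum_left', blockSum_right']

theorem Sl2Trace.valA_left_right (q m : ℕ) :
    R.valA (q + 1) (m + 1) = R.blockSum q m fun w z => ∑ p, ∑ y, ∑ s,
      R.tr (R.J s * (R.J p * w) * R.J s * (R.J y * z) * (R.J p * w) * (R.J y * z)) := by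
  rw [valA, blockSum_right, blockSum_left]

theorem Sl2Trace.valA_left_left (q m : ℕ) :
    R.valA (q + 2) m = R.blockSum q m fun w z => ∑ p, ∑ y, ∑ s,
      R.tr (R.J s * (R.J p * (w * R.J y)) * R.J s * z * (R.J p * (w * R.J y)) * z) := by
  rw [valA, blockSum_left', blockSum_left]
  simp only [mul_assoc]

/-- Two chords `p`, `y` are singled out at the ends of the blocks, next to the two ends of the chord
`s`. Sliding the ends of `s` past them yields the four terms of a product of two commutators with `J
s`; the mixed terms are two ways of splitting `A(q+1,m+1)`. In `sum_commutator_commutator` the delta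
term is `B(q,m)` and the exchange term is `B(m,q)`. -/
theorem Sl2Trace.valA_second_difference (q m : ℕ) :
    R.valA q (m + 2) - 2 * R.valA (q + 1) (m + 1) + R.valA (q + 2) m =
      R.valB q m - R.valB m q := by
  have key : ∀ Q Z : A, ∑ p, ∑ y, ∑ s,
      R.tr (R.J s * Q * R.J s * (R.J y * (Z * R.J p)) * Q * (R.J y * (Z * R.J p))) -
      ∑ p, ∑ y, ∑ s,
      R.tr (R.J s * (Q * R.J y) * R.J s * (Z * R.J p) * (Q * R.J y) * (Z * R.J p)) -
      ∑ p, ∑ y, ∑ s,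
      R.tr (R.J s * (R.J p * Q) * R.J s * (R.J y * Z) * (R.J p * Q) * (R.J y * Z)) +
      ∑ p, ∑ y, ∑ s,
      R.tr (R.J s * (R.J p * (Q * R.J y)) * R.J s * Z * (R.J p * (Q * R.J y)) * Z) =
      ∑ u, ∑ v, R.tr (R.J u * Q * R.J u * Z * R.J v * Q * R.J v * Z) -
      ∑ u, ∑ v, R.tr (R.J u * Z * R.J u * Q * R.J v * Z * R.J v * Q) := by
    intro Q Z
    have h1 : ∀ p y, ∑ s, R.cut Q (Z * R.J p * Q * R.J y * Z)
        (R.J p * R.J s - R.J s * R.J p) (R.J s * R.J y - R.J y * R.J s) =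
        ∑ s, R.tr (R.J s * Q * R.J s * (R.J y * (Z * R.J p)) * Q * (R.J y * (Z * R.J p))) -
        ∑ s, R.tr (R.J s * (Q * R.J y) * R.J s * (Z * R.J p) * (Q * R.J y) * (Z * R.J p)) -
        ∑ s, R.tr (R.J s * (R.J p * Q) * R.J s * (R.J y * Z) * (R.J p * Q) * (R.J y * Z)) +
        ∑ s, R.tr (R.J s * (R.J p * (Q * R.J y)) * R.J s * Z * (R.J p * (Q * R.J y)) * Z) := by
      intro p y
      rw [← Finset.sum_sub_distrib, ← Finset.sum_sub_distrib, ← Finset.sum_add_distrib]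
      refine Finset.sum_congr rfl fun s _ => ?_
      have r1 : R.tr (R.J s * Q * R.J s * (R.J y * (Z * R.J p)) * Q * (R.J y * (Z * R.J p))) =
          R.tr (R.J p * (R.J s * Q * R.J s * (R.J y * (Z * R.J p)) * Q * (R.J y * Z))) := by
        rw [R.tr_mul_comm (R.J p)]
        simp only [mul_assoc]
      have r2 : R.tr (R.J s * (Q * R.J y) * R.J s * (Z * R.J p) * (Q * R.J y) * (Z * R.J p)) =
          R.tr (R.J p * (R.J s * (Q * R.J y) * R.J s * (Z * R.J p) * (Q * R.J y) * Z)) := by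
        rw [R.tr_mul_comm (R.J p)]
        simp only [mul_assoc]
      rw [r1, r2, R.cut_apply, ← map_sub, ← map_sub, ← map_add]
      congr 1
      noncomm_ring
    simp only [← Finset.sum_sub_distrib, ← Finset.sum_add_distrib] at h1 ⊢
    rw [Finset.sum_congr rfl fun p _ => Finset.sum_congr rfl fun y _ => (h1 p y).symm]
    simp only [R.sum_commutator_commutator, Finset.sum_sub_distrib, Finset.sum_ite_eq,
      Finset.mem_univ, if_true]
    rw [Finset.sum_comm]
    congr 1
    · refine Finset.sum_congr rfl fun u _ => Finset.sum_congr rfl fun v _ => ?_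
      rw [R.cut_apply]
      simp only [mul_assoc]
    · rw [Finset.sum_comm]
      refine Finset.sum_congr rfl fun u _ => Finset.sum_congr rfl fun v _ => ?_
      rw [R.cut_apply, ← mul_assoc, ← mul_assoc, ← mul_assoc, mul_assoc _ (R.J u) Z,
        R.tr_mul_comm]
      simp only [mul_assoc]
  have h := congrArg (R.blockSum q m) (funext fun Q => funext fun Z => key Q Z)
  rw [R.blockSum_add, R.blockSum_sub, R.blockSum_sub, R.blockSum_sub, ← R.valA_right_right,
    ← R.valA_left'_right', ← R.valA_left_right, ← R.valA_left_left] at h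
  have hB : R.valB m q = R.blockSum q m fun w z => ∑ u, ∑ v,
      R.tr (R.J u * z * R.J u * w * R.J v * z * R.J v * w) := by rw [valB, blockSum_swap]
  rw [hB, valB, ← h]
  ring

/-- With one letter split off at a suitable end, and the blocks interchanged in the last two terms,
the left side is that of `exchange_identity`. On the right side of that identity the commutators are
expanded, and cyclicity of the trace identifies each term with a value `A`. -/
theorem Sl2Trace.valB_difference (q m : ℕ) :
    R.valB q (m + 1) - R.valB (q + 1) m + R.valB m (q + 1) - R.valB (m + 1) q =
      R.valA q (m + 2) - R.valA (q + 2) m + 2 * R.x * (R.valA q (m + 1) - R.valA (q + 1) m) := by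
  have rot : ∀ F : Fin 3 → Fin 3 → Fin 3 → ℂ, ∑ y, ∑ u, ∑ v, F u v y =
      ∑ u, ∑ v, ∑ y, F u v y := by
    intro F
    rw [Finset.sum_comm]
    exact Finset.sum_congr rfl fun u _ => Finset.sum_comm
  have b1 : R.valB q (m + 1) = R.blockSum q m fun w z => ∑ u, ∑ v, ∑ y,
      R.tr (R.J u * w * R.J u * R.J y * z * R.J v * w * R.J v * R.J y * z) := by
    rw [valB, blockSum_right]
    refine congrArg (R.blockSum q m) (funext fun w => funext fun z => (rot _).trans ?_)
    simp only [mul_assoc]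
  have b2 : R.valB (q + 1) m = R.blockSum q m fun w z => ∑ u, ∑ v, ∑ y,
      R.tr (R.J u * w * R.J y * R.J u * z * R.J v * w * R.J y * R.J v * z) := by
    rw [valB, blockSum_left']
    refine congrArg (R.blockSum q m) (funext fun w => funext fun z => (rot _).trans ?_)
    simp only [mul_assoc]
  have b3 : R.valB m (q + 1) = R.blockSum q m fun w z => ∑ u, ∑ v, ∑ y,
      R.tr (R.J u * w * R.J y * R.J v * z * R.J v * w * R.J y * R.J u * z) := by
    rw [valB, blockSum_right', blockSum_swap]
    refine congrArg (R.blockSum q m) (funext fun w => funext fun z => (rot _).trans ?_)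
    refine Finset.sum_congr rfl fun u _ => Finset.sum_congr rfl fun v _ =>
      Finset.sum_congr rfl fun y _ => ?_
    rw [mul_assoc _ (R.J u) z, R.tr_mul_comm _ (R.J u * z)]
    simp only [mul_assoc]
  have b4 : R.valB (m + 1) q = R.blockSum q m fun w z => ∑ u, ∑ v, ∑ y,
      R.tr (R.J u * w * R.J v * R.J y * z * R.J v * w * R.J u * R.J y * z) := by
    rw [valB, blockSum_left, blockSum_swap]
    refine congrArg (R.blockSum q m) (funext fun w => funext fun z => (rot _).trans ?_)
    refine Finset.sum_congr rfl fun u _ => Finset.sum_congr rfl fun v _ =>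
      Finset.sum_congr rfl fun y _ => ?_
    rw [mul_assoc _ (R.J u) (R.J y), mul_assoc _ (R.J u * R.J y) z,
      R.tr_mul_comm _ (R.J u * R.J y * z)]
    simp only [mul_assoc]
  have a5 : R.valA q (m + 1) = R.blockSum q m fun w z => ∑ c, ∑ t,
      R.tr (R.J t * w * R.J t * (z * R.J c) * w * (z * R.J c)) := by
    rw [valA, blockSum_right']
  have a6 : R.valA (q + 1) m = R.blockSum q m fun w z => ∑ c, ∑ t,
      R.tr (R.J t * (R.J c * w) * R.J t * z * (R.J c * w) * z) := by
    rw [valA, blockSum_left]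
  have key : ∀ W Z : A,
      (∑ u, ∑ v, ∑ y, R.tr (R.J u * W * R.J u * R.J y * Z * R.J v * W * R.J v * R.J y * Z) -
      ∑ u, ∑ v, ∑ y, R.tr (R.J u * W * R.J y * R.J u * Z * R.J v * W * R.J y * R.J v * Z) +
      ∑ u, ∑ v, ∑ y, R.tr (R.J u * W * R.J y * R.J v * Z * R.J v * W * R.J y * R.J u * Z) -
      ∑ u, ∑ v, ∑ y, R.tr (R.J u * W * R.J v * R.J y * Z * R.J v * W * R.J u * R.J y * Z)) =
      ∑ p, ∑ y, ∑ s,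
        R.tr (R.J s * W * R.J s * (R.J y * (Z * R.J p)) * W * (R.J y * (Z * R.J p))) -
      ∑ p, ∑ y, ∑ s,
        R.tr (R.J s * (R.J p * W) * R.J s * (R.J y * Z) * (R.J p * W) * (R.J y * Z)) +
      ∑ p, ∑ y, ∑ s,
        R.tr (R.J s * (W * R.J y) * R.J s * (Z * R.J p) * (W * R.J y) * (Z * R.J p)) -
      ∑ p, ∑ y, ∑ s,
        R.tr (R.J s * (R.J p * (W * R.J y)) * R.J s * Z * (R.J p * (W * R.J y)) * Z) +
      2 * R.x * (∑ c, ∑ t, R.tr (R.J t * W * R.J t * (Z * R.J c) * W * (Z * R.J c)) -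
        ∑ c, ∑ t, R.tr (R.J t * (R.J c * W) * R.J t * Z * (R.J c * W) * Z)) := by
    intro W Z
    have h1 : ∀ t c a, R.tr (R.J c * W * R.J a * Z * (R.J c * R.J t - R.J t * R.J c) * W *
        R.J a * R.J t * Z) =
        R.tr (R.J t * (W * R.J a) * R.J t * (Z * R.J c) * (W * R.J a) * (Z * R.J c)) -
        R.tr (R.J t * (R.J c * (W * R.J a)) * R.J t * Z * (R.J c * (W * R.J a)) * Z) := by
      intro t c a
      have e1 : R.J c * W * R.J a * Z * (R.J c * R.J t - R.J t * R.J c) * W * R.J a * R.J t * Z =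
          (R.J c * W * R.J a * Z * R.J c) * (R.J t * W * R.J a * R.J t * Z) -
          (R.J c * W * R.J a * Z) * (R.J t * R.J c * W * R.J a * R.J t * Z) := by noncomm_ring
      rw [e1, map_sub, R.tr_mul_comm, R.tr_mul_comm (R.J c * W * R.J a * Z)]
      simp only [mul_assoc]
    have h2 : ∀ t c a, R.tr ((R.J c * R.J t - R.J t * R.J c) * W * R.J t * R.J a * Z * R.J c *
        W * R.J a * Z) =
        R.tr (R.J t * W * R.J t * (R.J a * (Z * R.J c)) * W * (R.J a * (Z * R.J c))) -
        R.tr (R.J t * (R.J c * W) * R.J t * (R.J a * Z) * (R.J c * W) * (R.J a * Z)) := by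
      intro t c a
      have e1 : (R.J c * R.J t - R.J t * R.J c) * W * R.J t * R.J a * Z * R.J c * W * R.J a * Z =
          R.J c * (R.J t * W * R.J t * R.J a * Z * R.J c * W * R.J a * Z) -
          R.J t * R.J c * W * R.J t * R.J a * Z * R.J c * W * R.J a * Z := by noncomm_ring
      rw [e1, map_sub, R.tr_mul_comm]
      simp only [mul_assoc]
    have h3 : ∀ t c, R.tr ((R.J c * R.J t - R.J t * R.J c) * W * R.J t * Z * R.J c * W * Z) =
        R.tr (R.J t * W * R.J t * (Z * R.J c) * W * (Z * R.J c)) -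
        R.tr (R.J t * (R.J c * W) * R.J t * Z * (R.J c * W) * Z) := by
      intro t c
      have e1 : (R.J c * R.J t - R.J t * R.J c) * W * R.J t * Z * R.J c * W * Z =
          R.J c * (R.J t * W * R.J t * Z * R.J c * W * Z) -
          R.J t * R.J c * W * R.J t * Z * R.J c * W * Z := by noncomm_ring
      rw [e1, map_sub, R.tr_mul_comm]
      simp only [mul_assoc]
    have h4 : ∀ t c, R.tr (R.J c * W * Z * (R.J c * R.J t - R.J t * R.J c) * W * R.J t * Z) =
        R.tr (R.J t * W * R.J t * (Z * R.J c) * W * (Z * R.J c)) -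
        R.tr (R.J t * (R.J c * W) * R.J t * Z * (R.J c * W) * Z) := by
      intro t c
      have e1 : R.J c * W * Z * (R.J c * R.J t - R.J t * R.J c) * W * R.J t * Z =
          (R.J c * W * Z * R.J c) * (R.J t * W * R.J t * Z) -
          (R.J c * W * Z) * (R.J t * R.J c * W * R.J t * Z) := by noncomm_ring
      rw [e1, map_sub, R.tr_mul_comm, R.tr_mul_comm (R.J c * W * Z)]
      simp only [mul_assoc]
    have h := R.exchange_identity W Z
    simp only [h1, h2, h3, h4, Finset.sum_add_distrib, Finset.sum_sub_distrib] at h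
    have k1 := rot fun c a t =>
      R.tr (R.J t * W * R.J t * (R.J a * (Z * R.J c)) * W * (R.J a * (Z * R.J c)))
    have k2 := rot fun c a t =>
      R.tr (R.J t * (R.J c * W) * R.J t * (R.J a * Z) * (R.J c * W) * (R.J a * Z))
    have k3 := rot fun c a t =>
      R.tr (R.J t * (W * R.J a) * R.J t * (Z * R.J c) * (W * R.J a) * (Z * R.J c))
    have k4 := rot fun c a t =>
      R.tr (R.J t * (R.J c * (W * R.J a)) * R.J t * Z * (R.J c * (W * R.J a)) * Z)
    have k5 := Finset.sum_comm (s := Finset.univ) (t := Finset.univ) (f := fun t c =>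
      R.tr (R.J t * W * R.J t * (Z * R.J c) * W * (Z * R.J c)))
    have k6 := Finset.sum_comm (s := Finset.univ) (t := Finset.univ) (f := fun t c =>
      R.tr (R.J t * (R.J c * W) * R.J t * Z * (R.J c * W) * Z))
    linear_combination h + k1 - k2 + k3 - k4 + 2 * R.x * (k5 - k6)
  have h := congrArg (R.blockSum q m) (funext fun W => funext fun Z => key W Z)
  simp only [R.blockSum_sub, R.blockSum_add, R.blockSum_mul_left] at h
  have a1 := R.valA_right_right q m
  have a2 := R.valA_left_right q m
  have a3 := R.valA_left'_right' q m
  have a4 := R.valA_left_left q m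
  linear_combination h + b1 - b2 + b3 - b4 - a1 + a2 - a3 + a4 - 2 * R.x * (a5 - a6)

/-! ### Diagrams given by a list of chords -/

/-- Sum over the colors of a list of chords. -/
def chordSum : List (ℕ × ℕ) → ((ℕ → Fin 3) → ℂ) → (ℕ → Fin 3) → ℂ
  | [], F => F
  | c :: C, F => fun κ => ∑ t, chordSum C F (Function.update (Function.update κ c.1 t) c.2 t)

theorem chordSum_append (C C' : List (ℕ × ℕ)) (F : (ℕ → Fin 3) → ℂ) :
    chordSum (C ++ C') F = chordSum C (chordSum C' F) := by
  induction C with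
  | nil => rfl
  | cons c C ih => simp only [List.cons_append, chordSum, ih]

/-- The endpoints of a list of chords. -/
def endpoints (C : List (ℕ × ℕ)) : List ℕ := C.flatMap fun c => [c.1, c.2]

/-- The set of chords of a list. -/
def chordSet (C : List (ℕ × ℕ)) : Finset (Sym2 ℕ) := (C.map fun c => s(c.1, c.2)).toFinset

theorem endpoints_cons (c : ℕ × ℕ) (C : List (ℕ × ℕ)) :
    endpoints (c :: C) = c.1 :: c.2 :: endpoints C := rfl

theorem endpoints_append (C C' : List (ℕ × ℕ)) :
    endpoints (C ++ C') = endpoints C ++ endpoints C' := by simp [endpoints]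

theorem chordSet_cons (c : ℕ × ℕ) (C : List (ℕ × ℕ)) :
    chordSet (c :: C) = insert s(c.1, c.2) (chordSet C) := by simp [chordSet]

theorem mem_points_chordSet {C : List (ℕ × ℕ)} {p : ℕ} :
    p ∈ points (chordSet C) ↔ p ∈ endpoints C := by
  induction C with
  | nil => simp [chordSet, endpoints, points]
  | cons c C ih =>
    rw [chordSet_cons, mem_points_insert, ih, endpoints_cons, List.mem_cons, List.mem_cons]

theorem isChordDiagram_chordSet {C : List (ℕ × ℕ)} (h : (endpoints C).Nodup) :
    IsChordDiagram (chordSet C) := by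
  induction C with
  | nil => simp [chordSet, IsChordDiagram]
  | cons c C ih =>
    simp only [endpoints_cons, List.nodup_cons, List.mem_cons, not_or] at h
    rw [← mem_points_chordSet, ← mem_points_chordSet] at h
    rw [chordSet_cons, isChordDiagram_insert (notMem_of_notMem_points h.1.2)]
    exact ⟨h.1.1, ih h.2.2, h.1.2, h.2.1⟩

theorem colorSumList_mul_left_of_update (L : List ℕ) (g F : (ℕ → Fin 3) → ℂ)
    (hg : ∀ p ∈ L, ∀ κ l, g (Function.update κ p l) = g κ) (κ : ℕ → Fin 3) :
    colorSumList L (fun κ => g κ * F κ) κ = g κ * colorSumList L F κ := by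
  induction L generalizing κ with
  | nil => rfl
  | cons p L ih =>
    simp only [colorSumList_cons, colorSum, Finset.mul_sum]
    refine Finset.sum_congr rfl fun c _ => ?_
    rw [ih fun q hq => hg q (List.mem_cons_of_mem _ hq), hg p List.mem_cons_self]

/-- The delta of each chord collapses the two sums over its endpoints into one sum over a common
color. -/
theorem colorSumList_endpoints {C : List (ℕ × ℕ)} (h : (endpoints C).Nodup)
    (F : (ℕ → Fin 3) → ℂ) (κ : ℕ → Fin 3) :
    colorSumList (endpoints C) (fun κ => diagramDelta (chordSet C) κ * F κ) κ =
      chordSum C F κ := by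
  induction C generalizing κ with
  | nil => simp [endpoints, chordSet, diagramDelta, chordSum]
  | cons c C ih =>
    simp only [endpoints_cons, List.nodup_cons, List.mem_cons, not_or] at h
    obtain ⟨⟨h1, h2⟩, h3, h4⟩ := h
    have h5 : s(c.1, c.2) ∉ chordSet C :=
      notMem_of_notMem_points (by rwa [mem_points_chordSet])
    have h6 : ∀ κ, colorSumList (endpoints C)
        (fun κ => diagramDelta (chordSet (c :: C)) κ * F κ) κ =
        chordDelta s(c.1, c.2) κ * chordSum C F κ := by
      intro κ
      simp only [chordSet_cons, diagramDelta_insert h5, mul_assoc]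
      rw [colorSumList_mul_left_of_update, ih h4]
      intro p hp κ l
      refine chordDelta_update (fun hp' => ?_) κ l
      rcases Sym2.mem_iff.1 hp' with rfl | rfl
      exacts [h2 hp, h3 hp]
    simp only [endpoints_cons, colorSumList_cons, colorSum, h6, chordDelta_mk, chordSum,
      Function.update_self, Function.update_of_ne h1]
    refine Finset.sum_congr rfl fun t _ => ?_
    simp

theorem Sl2Trace.diagramVal_chordSet {C : List (ℕ × ℕ)} {L : List ℕ} (hL : L.Pairwise (· < ·))
    (hC : L.Perm (endpoints C)) :
    R.diagramVal (chordSet C) = chordSum C (fun κ => R.tr (R.word L κ)) 0 := by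
  have h1 : (points (chordSet C)).sort = L :=
    sort_points_eq hL fun p => by rw [mem_points_chordSet, hC.mem_iff]
  rw [Sl2Trace.diagramVal, Sl2Trace.val, h1, colorSumList_perm hC,
    colorSumList_endpoints (hC.nodup_iff.1 hL.sortedLT.nodup)]

theorem Sl2Trace.aeval_weight_chordSet {C : List (ℕ × ℕ)} {L : List ℕ}
    (hL : L.Pairwise (· < ·)) (hC : L.Perm (endpoints C)) :
    aeval R.x (weight (chordSet C)) = chordSum C (fun κ => R.tr (R.word L κ)) 0 := by
  rw [R.aeval_weight (isChordDiagram_chordSet (hC.nodup_iff.1 hL.sortedLT.nodup)),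
    R.diagramVal_chordSet hL hC]

/-- The chords `(r + i, r' + i)`, `i < a`. -/
def parallelChords : ℕ → ℕ → ℕ → List (ℕ × ℕ)
  | _, _, 0 => []
  | r, r', a + 1 => (r, r') :: parallelChords (r + 1) (r' + 1) a

theorem mem_parallelChords {r r' a : ℕ} {c : ℕ × ℕ} :
    c ∈ parallelChords r r' a ↔ ∃ i < a, c = (r + i, r' + i) := by
  induction a generalizing r r' with
  | zero => simp [parallelChords]
  | succ a ih =>
    rw [parallelChords, List.mem_cons, ih]
    constructor
    · rintro (rfl | ⟨i, hi, rfl⟩)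
      · exact ⟨0, by omega, rfl⟩
      · exact ⟨i + 1, by omega, by rw [Prod.mk.injEq]; omega⟩
    · rintro ⟨i, hi, rfl⟩
      rcases Nat.eq_zero_or_pos i with rfl | h
      · exact Or.inl rfl
      · exact Or.inr ⟨i - 1, by omega, by rw [Prod.mk.injEq]; omega⟩

theorem endpoints_parallelChords (r r' a : ℕ) :
    (endpoints (parallelChords r r' a)).Perm (List.range' r a ++ List.range' r' a) := by
  induction a generalizing r r' with
  | zero => simp [parallelChords, endpoints]
  | succ a ih =>
    rw [parallelChords, endpoints_cons, List.range'_succ, List.range'_succ, List.cons_append]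
    exact (((ih _ _).cons r').trans List.perm_middle.symm).cons r

/-- Both sets of endpoints occur in the same order, so common colors make the two words equal. `hG`
says that the rest of the circle does not see these colors; the induction absorbs the first letter
of each word into `G`. -/
theorem Sl2Trace.chordSum_parallelChords {r r' a : ℕ} (h : r + a ≤ r')
    (G : (ℕ → Fin 3) → A → A → ℂ)
    (hG : ∀ κ p l, (r ≤ p ∧ p < r + a) ∨ (r' ≤ p ∧ p < r' + a) → G (Function.update κ p l) = G κ)
    (κ : ℕ → Fin 3) :
    chordSum (parallelChords r r' a)
      (fun κ => G κ (R.word (List.range' r a) κ) (R.word (List.range' r' a) κ)) κ =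
      R.wordSum a fun w => G κ w w := by
  induction a generalizing r r' G κ with
  | zero => simp [parallelChords, chordSum, Sl2Trace.word, wordSum_zero]
  | succ a ih =>
    simp only [parallelChords, chordSum, List.range'_succ, R.word_cons]
    rw [R.wordSum_succ, R.wordSum_sum]
    refine Finset.sum_congr rfl fun t _ => ?_
    rw [ih (by omega) (fun κ w w' => G κ (R.J (κ r) * w) (R.J (κ r') * w'))]
    · have hne : r ≠ r' := by omega
      rw [hG _ _ _ (by omega), hG _ _ _ (by omega), Function.update_self,
        Function.update_of_ne hne, Function.update_self]
    · intro κ p l hp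
      have h1 : r ≠ p := by omega
      have h2 : r' ≠ p := by omega
      rw [hG _ _ _ (by omega), Function.update_of_ne h1, Function.update_of_ne h2]

/-! ### The values of the three families of diagrams -/

theorem sym2_mk_congr {a b c d : ℕ} (h : a = c) (h' : b = d) : s(a, b) = s(c, d) := by
  rw [h, h']

theorem exists_range'_append {s s' m : ℕ} {L : List ℕ} (h : ∃ m', L = List.range' s' m')
    (hs : s' = s + m) : ∃ m', List.range' s m ++ L = List.range' s m' := by
  obtain ⟨m', rfl⟩ := h
  exact ⟨m + m', by rw [hs, List.range'_append_1]⟩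

theorem exists_range'_cons {s s' : ℕ} {L : List ℕ} (h : ∃ m', L = List.range' s' m')
    (hs : s' = s + 1) : ∃ m', s :: L = List.range' s m' := by
  obtain ⟨m', rfl⟩ := h
  exact ⟨m' + 1, by rw [hs, List.range'_succ]⟩

theorem pairwise_of_exists_range' {s : ℕ} {L : List ℕ} (h : ∃ m', L = List.range' s m') :
    L.Pairwise (· < ·) := by
  obtain ⟨m', rfl⟩ := h
  exact List.pairwise_lt_range'

theorem mem_chordSet {C : List (ℕ × ℕ)} {c : Sym2 ℕ} :
    c ∈ chordSet C ↔ ∃ d ∈ C, s(d.1, d.2) = c := by simp [chordSet]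

theorem diagramD_eq (n : ℕ) : diagramD n = chordSet (parallelChords 1 (n + 1) n) := by
  ext c
  simp only [diagramD, Finset.mem_image, Finset.mem_Icc, mem_chordSet, mem_parallelChords]
  constructor
  · rintro ⟨i, hi, rfl⟩
    refine ⟨_, ⟨i - 1, by omega, rfl⟩, ?_⟩
    exact sym2_mk_congr (by omega) (by omega)
  · rintro ⟨_, ⟨i, hi, rfl⟩, rfl⟩
    refine ⟨i + 1, by omega, ?_⟩
    exact sym2_mk_congr (by omega) (by omega)

/-- The first block consists of `p_2, …, p_{k+1}`, the chords that meet `p_1`; the second of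
`p_{k+2}, …, p_n`, with `b = n - k - 1`. -/
theorem diagramA_eq (k b : ℕ) : diagramA (k + b + 1) k =
    chordSet ((1, k + 2) :: (parallelChords 2 (k + b + 3) k ++
      parallelChords (k + 3) (2 * k + b + 3) b)) := by
  ext c
  simp only [diagramA, Finset.mem_image, Finset.mem_Icc, mem_chordSet, List.mem_cons,
    List.mem_append, mem_parallelChords]
  constructor
  · rintro ⟨i, hi, rfl⟩
    split_ifs with h1 h2
    · exact ⟨_, Or.inl rfl, rfl⟩
    · refine ⟨_, Or.inr (Or.inl ⟨i - 2, by omega, rfl⟩), ?_⟩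
      exact sym2_mk_congr (by omega) (by omega)
    · refine ⟨_, Or.inr (Or.inr ⟨i - (k + 2), by omega, rfl⟩), ?_⟩
      exact sym2_mk_congr (by omega) (by omega)
  · rintro ⟨_, rfl | ⟨i, hi, rfl⟩ | ⟨i, hi, rfl⟩, rfl⟩
    · exact ⟨1, by omega, rfl⟩
    · refine ⟨i + 2, by omega, ?_⟩
      rw [if_neg (by omega), if_pos (by omega)]
      exact sym2_mk_congr (by omega) (by omega)
    · refine ⟨i + (k + 2), by omega, ?_⟩
      rw [if_neg (by omega), if_neg (by omega)]
      exact sym2_mk_congr (by omega) (by omega)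

/-- The blocks are as for `𝒜`, except that `p_n` is listed separately as the second of the two
parallel chords, so that `b = n - k - 2`. -/
theorem diagramB_eq (k b : ℕ) : diagramB (k + b + 2) k =
    chordSet ((1, k + 2) :: (k + b + 3, 2 * k + b + 4) :: (parallelChords 2 (k + b + 4) k ++
      parallelChords (k + 3) (2 * k + b + 5) b)) := by
  ext c
  simp only [diagramB, Finset.mem_image, Finset.mem_Icc, mem_chordSet, List.mem_cons,
    List.mem_append, mem_parallelChords]
  constructor
  · rintro ⟨i, hi, rfl⟩
    split_ifs with h1 h2 h3
    · exact ⟨_, Or.inl rfl, rfl⟩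
    · refine ⟨_, Or.inr (Or.inr (Or.inl ⟨i - 2, by omega, rfl⟩)), ?_⟩
      exact sym2_mk_congr (by omega) (by omega)
    · refine ⟨_, Or.inr (Or.inr (Or.inr ⟨i - (k + 2), by omega, rfl⟩)), ?_⟩
      exact sym2_mk_congr (by omega) (by omega)
    · refine ⟨_, Or.inr (Or.inl rfl), ?_⟩
      exact sym2_mk_congr (by omega) (by omega)
  · rintro ⟨_, rfl | rfl | ⟨i, hi, rfl⟩ | ⟨i, hi, rfl⟩, rfl⟩
    · exact ⟨1, by omega, rfl⟩
    · refine ⟨k + b + 2, by omega, ?_⟩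
      rw [if_neg (by omega), if_neg (by omega), if_neg (by omega)]
      exact sym2_mk_congr (by omega) (by omega)
    · refine ⟨i + 2, by omega, ?_⟩
      rw [if_neg (by omega), if_pos (by omega)]
      exact sym2_mk_congr (by omega) (by omega)
    · refine ⟨i + (k + 2), by omega, ?_⟩
      rw [if_neg (by omega), if_neg (by omega), if_pos (by omega)]
      exact sym2_mk_congr (by omega) (by omega)

theorem diagramB_last (n : ℕ) (hn : 1 ≤ n) : diagramB n (n - 1) = diagramD n := by
  unfold diagramB diagramD
  refine Finset.image_congr fun i hi => ?_
  rw [Finset.coe_Icc, Set.mem_Icc] at hi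
  split_ifs with h1 h2 h3
  · subst h1
    exact sym2_mk_congr rfl (by omega)
  · rfl
  · omega
  · omega

theorem Sl2Trace.aeval_weight_diagramD (n : ℕ) :
    aeval R.x (weight (diagramD n)) = R.valD n := by
  rw [diagramD_eq, R.aeval_weight_chordSet (L := List.range' 1 n ++ List.range' (n + 1) n)]
  · simp only [R.word_append]
    exact R.chordSum_parallelChords (by omega) (fun _ w w' => R.tr (w * w'))
      (fun _ _ _ _ => rfl) 0
  · exact pairwise_of_exists_range' (exists_range'_append ⟨_, rfl⟩ (by omega))
  · exact (endpoints_parallelChords _ _ _).symm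

theorem Sl2Trace.aeval_weight_diagramA (k b : ℕ) :
    aeval R.x (weight (diagramA (k + b + 1) k)) = R.valA k b := by
  rw [diagramA_eq, R.aeval_weight_chordSet (L := 1 :: (List.range' 2 k ++
    (k + 2) :: (List.range' (k + 3) b ++ (List.range' (k + b + 3) k ++
      List.range' (2 * k + b + 3) b))))]
  · simp only [chordSum, chordSum_append, R.word_append, R.word_cons]
    -- The second block is summed first, while the colors of the first block and of the chord `p_1`
    -- are held fixed.
    have h1 : ∀ κ : ℕ → Fin 3, chordSum (parallelChords (k + 3) (2 * k + b + 3) b)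
        (fun κ => R.tr (R.J (κ 1) * (R.word (List.range' 2 k) κ * (R.J (κ (k + 2)) *
          (R.word (List.range' (k + 3) b) κ * (R.word (List.range' (k + b + 3) k) κ *
            R.word (List.range' (2 * k + b + 3) b) κ)))))) κ =
        R.wordSum b fun z => R.tr (R.J (κ 1) * (R.word (List.range' 2 k) κ * (R.J (κ (k + 2)) *
          (z * (R.word (List.range' (k + b + 3) k) κ * z))))) := by
      intro κ
      refine R.chordSum_parallelChords (by omega) (fun κ z z' => R.tr (R.J (κ 1) *
        (R.word (List.range' 2 k) κ * (R.J (κ (k + 2)) * (z *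
          (R.word (List.range' (k + b + 3) k) κ * z')))))) (fun κ p l hp => ?_) κ
      rw [R.word_update (by rw [List.mem_range'_1]; omega),
        R.word_update (by rw [List.mem_range'_1]; omega),
        Function.update_of_ne (by omega), Function.update_of_ne (by omega)]
    simp only [funext h1]
    have h2 : ∀ κ : ℕ → Fin 3, chordSum (parallelChords 2 (k + b + 3) k)
        (fun κ => R.wordSum b fun z => R.tr (R.J (κ 1) * (R.word (List.range' 2 k) κ *
          (R.J (κ (k + 2)) * (z * (R.word (List.range' (k + b + 3) k) κ * z)))))) κ =
        R.wordSum k fun w => R.wordSum b fun z => R.tr (R.J (κ 1) * (w *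
          (R.J (κ (k + 2)) * (z * (w * z))))) := by
      intro κ
      refine R.chordSum_parallelChords (by omega) (fun κ w w' => R.wordSum b fun z =>
        R.tr (R.J (κ 1) * (w * (R.J (κ (k + 2)) * (z * (w' * z)))))) (fun κ p l hp => ?_) κ
      rw [Function.update_of_ne (by omega), Function.update_of_ne (by omega)]
    simp only [h2]
    have h3 : 1 ≠ k + 2 := by omega
    simp only [Function.update_self, Function.update_of_ne h3, valA, blockSum, R.wordSum_sum,
      mul_assoc]
  · exact pairwise_of_exists_range' (exists_range'_cons (exists_range'_append (exists_range'_cons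
      (exists_range'_append (exists_range'_append ⟨_, rfl⟩ (by omega)) (by omega)) (by omega))
      (by omega)) (by omega))
  · rw [endpoints_cons, endpoints_append]
    refine List.Perm.trans ?_ ((((endpoints_parallelChords _ _ _).append
      (endpoints_parallelChords _ _ _)).symm.cons _).cons _)
    simp only [List.perm_iff_count, List.count_append, List.count_cons]
    intro p
    omega

theorem Sl2Trace.aeval_weight_diagramB (k b : ℕ) :
    aeval R.x (weight (diagramB (k + b + 2) k)) = R.valB k b := by
  rw [diagramB_eq, R.aeval_weight_chordSet (L := 1 :: (List.range' 2 k ++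
    (k + 2) :: (List.range' (k + 3) b ++ (k + b + 3) :: (List.range' (k + b + 4) k ++
      (2 * k + b + 4) :: List.range' (2 * k + b + 5) b))))]
  · simp only [chordSum, chordSum_append, R.word_append, R.word_cons]
    have h1 : ∀ κ : ℕ → Fin 3, chordSum (parallelChords (k + 3) (2 * k + b + 5) b)
        (fun κ => R.tr (R.J (κ 1) * (R.word (List.range' 2 k) κ * (R.J (κ (k + 2)) *
          (R.word (List.range' (k + 3) b) κ * (R.J (κ (k + b + 3)) *
            (R.word (List.range' (k + b + 4) k) κ * (R.J (κ (2 * k + b + 4)) *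
              R.word (List.range' (2 * k + b + 5) b) κ)))))))) κ =
        R.wordSum b fun z => R.tr (R.J (κ 1) * (R.word (List.range' 2 k) κ * (R.J (κ (k + 2)) *
          (z * (R.J (κ (k + b + 3)) *
            (R.word (List.range' (k + b + 4) k) κ * (R.J (κ (2 * k + b + 4)) * z))))))) := by
      intro κ
      refine R.chordSum_parallelChords (by omega) (fun κ z z' => R.tr (R.J (κ 1) *
        (R.word (List.range' 2 k) κ * (R.J (κ (k + 2)) * (z * (R.J (κ (k + b + 3)) *
          (R.word (List.range' (k + b + 4) k) κ * (R.J (κ (2 * k + b + 4)) * z'))))))))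
        (fun κ p l hp => ?_) κ
      rw [R.word_update (by rw [List.mem_range'_1]; omega),
        R.word_update (by rw [List.mem_range'_1]; omega),
        Function.update_of_ne (by omega), Function.update_of_ne (by omega),
        Function.update_of_ne (by omega), Function.update_of_ne (by omega)]
    simp only [funext h1]
    have h2 : ∀ κ : ℕ → Fin 3, chordSum (parallelChords 2 (k + b + 4) k)
        (fun κ => R.wordSum b fun z => R.tr (R.J (κ 1) * (R.word (List.range' 2 k) κ *
          (R.J (κ (k + 2)) * (z * (R.J (κ (k + b + 3)) *
            (R.word (List.range' (k + b + 4) k) κ * (R.J (κ (2 * k + b + 4)) * z)))))))) κ =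
        R.wordSum k fun w => R.wordSum b fun z => R.tr (R.J (κ 1) * (w *
          (R.J (κ (k + 2)) * (z * (R.J (κ (k + b + 3)) * (w *
            (R.J (κ (2 * k + b + 4)) * z))))))) := by
      intro κ
      refine R.chordSum_parallelChords (by omega) (fun κ w w' => R.wordSum b fun z =>
        R.tr (R.J (κ 1) * (w * (R.J (κ (k + 2)) * (z * (R.J (κ (k + b + 3)) * (w' *
          (R.J (κ (2 * k + b + 4)) * z)))))))) (fun κ p l hp => ?_) κ
      rw [Function.update_of_ne (by omega), Function.update_of_ne (by omega),
        Function.update_of_ne (by omega), Function.update_of_ne (by omega)]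
    simp only [h2]
    have h3 : 1 ≠ k + 2 := by omega
    have h4 : 1 ≠ k + b + 3 := by omega
    have h5 : 1 ≠ 2 * k + b + 4 := by omega
    have h6 : k + 2 ≠ k + b + 3 := by omega
    have h7 : k + 2 ≠ 2 * k + b + 4 := by omega
    have h8 : k + b + 3 ≠ 2 * k + b + 4 := by omega
    simp only [Function.update_self, Function.update_of_ne h3, Function.update_of_ne h4,
      Function.update_of_ne h5, Function.update_of_ne h6, Function.update_of_ne h7,
      Function.update_of_ne h8, valB, blockSum, R.wordSum_sum, mul_assoc]
  · exact pairwise_of_exists_range' (exists_range'_cons (exists_range'_append (exists_range'_cons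
      (exists_range'_append (exists_range'_cons (exists_range'_append (exists_range'_cons
      ⟨_, rfl⟩ (by omega)) (by omega)) (by omega)) (by omega)) (by omega)) (by omega)) (by omega))
  · rw [endpoints_cons, endpoints_cons, endpoints_append]
    refine List.Perm.trans ?_ ((((((endpoints_parallelChords _ _ _).append
      (endpoints_parallelChords _ _ _)).symm.cons _).cons _).cons _).cons _)
    simp only [List.perm_iff_count, List.count_append, List.count_cons]
    intro p
    omega

/-! ### The weights of the three families of diagrams -/

theorem weight_diagramA_zero (b : ℕ) : weight (diagramA (b + 1) 0) = X * weight (diagramD b) :=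
  eq_of_forall_aeval_spin fun l => by
    have h := (spin l).aeval_weight_diagramA 0 b
    rw [zero_add] at h
    simp [h, (spin l).aeval_weight_diagramD, (spin l).valA_zero_left]

theorem weight_diagramA_last (k : ℕ) : weight (diagramA (k + 1) k) = weight (diagramD (k + 1)) :=
  eq_of_forall_aeval_spin fun l => by
    have h := (spin l).aeval_weight_diagramA k 0
    rw [add_zero] at h
    rw [h, (spin l).aeval_weight_diagramD, (spin l).valA_zero_right]

theorem weight_diagramA_one (b : ℕ) :
    weight (diagramA (b + 2) 1) = (X - 1) * weight (diagramD (b + 1)) :=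
  eq_of_forall_aeval_spin fun l => by
    have h := (spin l).aeval_weight_diagramA 1 b
    rw [show 1 + b + 1 = b + 2 by ring] at h
    simp [h, (spin l).aeval_weight_diagramD, (spin l).valA_one_left]

theorem weight_diagramB_zero (b : ℕ) :
    weight (diagramB (b + 2) 0) = X ^ 2 * weight (diagramD b) :=
  eq_of_forall_aeval_spin fun l => by
    have h := (spin l).aeval_weight_diagramB 0 b
    rw [zero_add] at h
    simp [h, (spin l).aeval_weight_diagramD, (spin l).valB_zero_left]

theorem weight_diagramB_penultimate (k : ℕ) :
    weight (diagramB (k + 2) k) = weight (diagramD (k + 2)) + weight (diagramD (k + 1)) :=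
  eq_of_forall_aeval_spin fun l => by
    have h := (spin l).aeval_weight_diagramB k 0
    rw [add_zero] at h
    simp [h, (spin l).aeval_weight_diagramD, (spin l).valB_zero_right]

theorem weight_diagramA_second_difference (q m : ℕ) :
    weight (diagramA (q + m + 3) q) - 2 * weight (diagramA (q + m + 3) (q + 1)) +
      weight (diagramA (q + m + 3) (q + 2)) =
      weight (diagramB (q + m + 2) q) - weight (diagramB (q + m + 2) m) :=
  eq_of_forall_aeval_spin fun l => by
    have h1 := (spin l).aeval_weight_diagramA q (m + 2)
    have h2 := (spin l).aeval_weight_diagramA (q + 1) (m + 1)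
    have h3 := (spin l).aeval_weight_diagramA (q + 2) m
    have h4 := (spin l).aeval_weight_diagramB q m
    have h5 := (spin l).aeval_weight_diagramB m q
    rw [show q + (m + 2) + 1 = q + m + 3 by ring] at h1
    rw [show q + 1 + (m + 1) + 1 = q + m + 3 by ring] at h2
    rw [show q + 2 + m + 1 = q + m + 3 by ring] at h3
    rw [show m + q + 2 = q + m + 2 by ring] at h5
    simp only [map_add, map_sub, map_mul, map_ofNat, h1, h2, h3, h4, h5]
    exact (spin l).valA_second_difference q m

theorem weight_diagramB_difference (q m : ℕ) :
    weight (diagramB (q + m + 3) q) - weight (diagramB (q + m + 3) (q + 1)) +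
      weight (diagramB (q + m + 3) m) - weight (diagramB (q + m + 3) (m + 1)) =
    weight (diagramA (q + m + 3) q) - weight (diagramA (q + m + 3) (q + 2)) +
      2 * X * (weight (diagramA (q + m + 2) q) - weight (diagramA (q + m + 2) (q + 1))) :=
  eq_of_forall_aeval_spin fun l => by
    have h1 := (spin l).aeval_weight_diagramA q (m + 2)
    have h2 := (spin l).aeval_weight_diagramA (q + 2) m
    have h3 := (spin l).aeval_weight_diagramA q (m + 1)
    have h4 := (spin l).aeval_weight_diagramA (q + 1) m
    have h5 := (spin l).aeval_weight_diagramB q (m + 1)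
    have h6 := (spin l).aeval_weight_diagramB (q + 1) m
    have h7 := (spin l).aeval_weight_diagramB m (q + 1)
    have h8 := (spin l).aeval_weight_diagramB (m + 1) q
    rw [show q + (m + 2) + 1 = q + m + 3 by ring] at h1
    rw [show q + 2 + m + 1 = q + m + 3 by ring] at h2
    rw [show q + (m + 1) + 1 = q + m + 2 by ring] at h3
    rw [show q + 1 + m + 1 = q + m + 2 by ring] at h4
    rw [show q + (m + 1) + 2 = q + m + 3 by ring] at h5
    rw [show q + 1 + m + 2 = q + m + 3 by ring] at h6
    rw [show m + (q + 1) + 2 = q + m + 3 by ring] at h7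
    rw [show m + 1 + q + 2 = q + m + 3 by ring] at h8
    simp only [map_add, map_sub, map_mul, map_ofNat, aeval_X, h1, h2, h3, h4, h5, h6, h7, h8]
    exact (spin l).valB_difference q m

/-! ### Identification with the polynomial Kreweras triangle. -/

theorem weight_diagramD_zero : weight (diagramD 0) = 1 := by
  simp [weight, diagramD, weightAux]

/-- The two claims need each other: row `n` of differences starts with the weight of `𝒟_n`, while
that weight is computed from the sum of the row before. Hence a joint strong induction on `n`, with
an inner one on `k`. -/
theorem weight_diagramD_eq_kreweras_and (n : ℕ) :
    weight (diagramD n) = krewerasAux n 1 ∧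
    ∀ k < n, weight (diagramA (n + 1) k) - weight (diagramA (n + 1) (k + 1)) =
      krewerasAux n (k + 1) := by
  induction n using Nat.strong_induction_on with
  | _ n ih =>
  have first : ∀ n, weight (diagramA (n + 2) 0) - weight (diagramA (n + 2) 1) =
      weight (diagramD (n + 1)) := by
    intro n
    rw [weight_diagramA_zero (n + 1), weight_diagramA_one]
    ring
  match n, ih with
  | 0, _ => exact ⟨by rw [weight_diagramD_zero, krewerasAux], by simp⟩
  | 1, _ =>
    have h1 : weight (diagramD 1) = X := by
      rw [← weight_diagramA_last 0, weight_diagramA_zero 0, weight_diagramD_zero, mul_one]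
    refine ⟨by rw [h1, krewerasAux], fun k hk => ?_⟩
    obtain rfl : k = 0 := by omega
    rw [first, h1, krewerasAux]
  | n + 2, ih =>
    have hD : weight (diagramD (n + 2)) = krewerasAux (n + 2) 1 := by
      obtain ⟨h1, h2⟩ := ih (n + 1) (by omega)
      -- The row `n + 1` telescopes to `x D_{n+1} - D_{n+2}`; solved for `D_{n+2}`, this is the
      -- recursion for the first column.
      have h3 := Finset.sum_range_sub' (fun k => weight (diagramA (n + 2) k)) (n + 1)
      rw [Finset.sum_congr rfl fun k hk => h2 k (Finset.mem_range.1 hk),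
        weight_diagramA_zero (n + 1), weight_diagramA_last (n + 1),
        Finset.sum_range_eq_add_Ico _ (Nat.succ_pos n)] at h3
      have h4 : ∑ i ∈ Finset.Ico 1 (n + 1), krewerasAux (n + 1) (i + 1) =
          ∑ i ∈ Finset.Icc 2 (n + 1), krewerasAux (n + 1) i := by
        rw [Finset.sum_Ico_add' (fun i => krewerasAux (n + 1) i) 1 (n + 1) 1]
        rfl
      rw [h4, zero_add, h1] at h3
      rw [krewerasAux]
      linear_combination h3
    refine ⟨hD, fun k => ?_⟩
    induction k using Nat.strong_induction_on with
    | _ k ihk =>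
    intro hk
    match k, ihk, hk with
    | 0, _, _ => rw [first (n + 1), hD]
    | 1, _, _ =>
      -- At the edge both `B` values are known: `x² D_n` and `D_{n+2} + D_{n+1}`.
      have h1 := weight_diagramA_second_difference 0 n
      simp only [zero_add] at h1
      rw [weight_diagramB_zero, weight_diagramB_penultimate] at h1
      have h2 := first (n + 1)
      rw [krewerasAux, ← hD, ← (ih (n + 1) (by omega)).1, ← (ih n (by omega)).1]
      linear_combination h2 - h1
    | j + 2, ihk, hk =>
      obtain ⟨m, rfl⟩ : ∃ m, n = j + m + 1 := ⟨n - j - 1, by omega⟩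
      -- Subtracting two consecutive second differences of `A` gives the second difference of the
      -- row, and leaves exactly the combination of `B` values evaluated by
      -- `weight_diagramB_difference`.
      have h1 := weight_diagramA_second_difference j (m + 1)
      have h2 := weight_diagramA_second_difference (j + 1) m
      rw [show j + (m + 1) + 3 = j + m + 4 by ring, show j + (m + 1) + 2 = j + m + 3 by ring] at h1
      rw [show j + 1 + m + 3 = j + m + 4 by ring, show j + 1 + m + 2 = j + m + 3 by ring,
        show j + 1 + 1 = j + 2 by ring, show j + 1 + 2 = j + 3 by ring] at h2
      have h3 := weight_diagramB_difference j m
      have k1 := ihk j (by omega) (by omega)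
      have k2 := ihk (j + 1) (by omega) (by omega)
      have l1 := (ih (j + m + 2) (by omega)).2 j (by omega)
      have l2 := (ih (j + m + 2) (by omega)).2 (j + 1) (by omega)
      have l3 := (ih (j + m + 1) (by omega)).2 j (by omega)
      change weight (diagramA (j + m + 4) (j + 2)) - weight (diagramA (j + m + 4) (j + 3)) =
        krewerasAux (j + m + 1 + 2) (j + 3)
      change weight (diagramA (j + m + 4) j) - weight (diagramA (j + m + 4) (j + 1)) =
        krewerasAux (j + m + 1 + 2) (j + 1) at k1
      change weight (diagramA (j + m + 4) (j + 1)) - weight (diagramA (j + m + 4) (j + 2)) =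
        krewerasAux (j + m + 1 + 2) (j + 2) at k2
      change weight (diagramA (j + m + 3) j) - weight (diagramA (j + m + 3) (j + 1)) =
        krewerasAux (j + m + 1 + 1) (j + 1) at l1
      change weight (diagramA (j + m + 3) (j + 1)) - weight (diagramA (j + m + 3) (j + 2)) =
        krewerasAux (j + m + 1 + 1) (j + 2) at l2
      change weight (diagramA (j + m + 2) j) - weight (diagramA (j + m + 2) (j + 1)) =
        krewerasAux (j + m + 1) (j + 1) at l3
      rw [krewerasAux, ← k1, ← k2, ← l1, ← l2, ← l3]
      linear_combination h1 - h2 + h3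

theorem weight_diagramD_eq_kreweras (n : ℕ) : weight (diagramD n) = kreweras n 1 :=
  (weight_diagramD_eq_kreweras_and n).1

theorem weight_diagramA_sub {n k : ℕ} (hk : k < n) :
    weight (diagramA (n + 1) k) - weight (diagramA (n + 1) (k + 1)) = kreweras n (k + 1) :=
  (weight_diagramD_eq_kreweras_and n).2 k hk

theorem polyA_sub {n k : ℕ} (hn : 1 ≤ n) (hk : k ≤ n - 1) :
    polyA n ((k : ℤ) - 1) - polyA n (k : ℤ) = kreweras (n - 1) k := by
  obtain ⟨n, rfl⟩ : ∃ m, n = m + 1 := ⟨n - 1, by omega⟩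
  rcases k with _ | k
  · have h := weight_diagramD_eq_kreweras n
    -- For `k = 0` the conventions `A_{n,-1} = 0` and `K_{n-1,0} = -x K_{n-1,1}` match, since the
    -- chord `p_1` of `𝒜_{n,0}` is isolated.
    simp [polyA, kreweras] at h ⊢
    rw [weight_diagramA_zero, h]
  · have h := weight_diagramA_sub (n := n) (k := k) (by omega)
    have h1 : ((k + 1 : ℕ) : ℤ) - 1 = (k : ℤ) := by push_cast; ring
    rw [h1, polyA, polyA, if_neg (by omega), if_neg (by omega), Int.toNat_natCast,
      Int.toNat_natCast, h]
    rfl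

/-- For `k ≥ 1` this is the second-difference relation for `A`, whose left side is a difference of
two consecutive entries of row `n`; for `k = 0` it holds by the conventions at `-1` and `ℬ_{n,n-1} =
𝒟_n`. -/
theorem polyB_sub {n k : ℕ} (hn : 1 ≤ n) (hk : k ≤ n - 1) :
    polyB n ((k : ℤ) - 1) - polyB n ((n : ℤ) - (k : ℤ) - 1) =
      kreweras n k - kreweras n (k + 1) := by
  rcases k with _ | k
  · have h := weight_diagramD_eq_kreweras n
    have h1 : (n : ℤ) - ((0 : ℕ) : ℤ) - 1 = ((n - 1 : ℕ) : ℤ) := by omega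
    rw [h1, polyB, polyB, if_pos (by simp), if_neg (by omega), Int.toNat_natCast,
      diagramB_last n hn, zero_add, h]
    rfl
  · obtain ⟨m, rfl⟩ : ∃ m, n = k + m + 2 := ⟨n - k - 2, by omega⟩
    have h1 : ((k + 1 : ℕ) : ℤ) - 1 = (k : ℤ) := by push_cast; ring
    have h2 : ((k + m + 2 : ℕ) : ℤ) - ((k + 1 : ℕ) : ℤ) - 1 = (m : ℤ) := by push_cast; ring
    rw [h1, h2, polyB, polyB, if_neg (by omega), if_neg (by omega), Int.toNat_natCast,
      Int.toNat_natCast, ← weight_diagramA_second_difference,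
      ← weight_diagramA_sub (n := k + m + 2) (k := k) (by omega),
      ← weight_diagramA_sub (n := k + m + 2) (k := k + 1) (by omega)]
    ring

end ChordWeight

theorem theorem1 :
    ChordWeight.IsUniversalSl2Weight ChordWeight.weight ∧
    (∀ n k : ℕ, 1 ≤ n → k ≤ n - 1 →
      ChordWeight.polyA n ((k : ℤ) - 1) - ChordWeight.polyA n (k : ℤ)
          = ChordWeight.kreweras (n - 1) k ∧
      ChordWeight.polyB n ((k : ℤ) - 1) - ChordWeight.polyB n ((n : ℤ) - (k : ℤ) - 1)
          = ChordWeight.kreweras n k - ChordWeight.kreweras n (k + 1)) ∧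
    (∀ n : ℕ, 1 ≤ n →
      ChordWeight.weight (ChordWeight.diagramD n) = ChordWeight.kreweras n 1) :=
  ⟨ChordWeight.isUniversalSl2Weight_weight,
    fun _ _ hn hk => ⟨ChordWeight.polyA_sub hn hk, ChordWeight.polyB_sub hn hk⟩,
    fun n _ => ChordWeight.weight_diagramD_eq_kreweras n⟩
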